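/- Consider the Stahl model: $n\ge 2$ sellers with one store each and zero production cost set prices in $[0,M]$, simultaneously and independently, each according to a (possibly mixed) strategy, i.e. a probability distribution on $[0,M]$. There is a unit mass of buyers, each buying one unit. A fraction $\mu\in(0,1)$ of them are shoppers, who buy at the cheapest store (ties are broken uniformly). The others are searchers: they visit stores in a uniformly random order, the first visit being free and every further one costing $c>0$; they stop as soon as they observe a price $\le P_M$ (their common reserve price) or when all stores have been visited, and then buy at the cheapest visited store (ties are broken uniformly). The profit of a seller is the expectation of her price times the quantity that she sells. A Nash equilibrium with reserve price $P_M$, where $c\le P_M\le M$ (searchers accept every price below $c$), consists of strategies $F_1,\dots,F_n$ of the sellers such that no seller can increase her expected profit by changing her own strategy ($P_M$ being fixed), and such that $P_M$ is rational for searchers who know how many sellers use each strategy but not which sellers they are: almost surely, whenever a searcher who has been unsatisfied so far observes a price and an unvisited store remains, then, $e$ being the conditional expectation of the price in the next store given the observed prices and $q$ the lowest observed price, $q\le e+c$ if she stops and $e+c\le q$ if she goes on. Let $P_L=P_M\frac{1-\mu}{(n-1)\mu+1}$, i.e. $P_L\left(\mu+\frac{1-\mu}{n}\right)=P_M\frac{1-\mu}{n}$.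 Theorem. In every Nash equilibrium with reserve price $P_M$ there is a probability distribution on $\mathbb R$, with continuous distribution function $F$ and with support exactly $[P_L,P_M]$ (it may depend on the equilibrium), such that at least two sellers use the strategy $F$, and every seller belongs to one of the following three groups: (i) sellers who use the strategy $F$; (ii) sellers (possibly none) who choose $P_M$ as a pure strategy; (iii) sellers (possibly none) with an individual cutoff price $p_i$, $P_L<p_i<P_M$: the support of their strategy is $[P_L,p_i]\cup\{P_M\}$, there is a mass point at $P_M$, and the distribution function of their strategy agrees with $F$ on $(-\infty,p_i]$. Moreover, every seller has the same expected profit $P_M(1-\mu)/n$. -/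

import Mathlib

open MeasureTheory ProbabilityTheory Set
open scoped ENNReal Nat

noncomputable section

/-- The primitives of the (original) Stahl model: `n ≥ 2` identical sellers with one store each and
zero production cost, a fraction `μ ∈ (0, 1)` of shoppers (the remaining buyers, of mass `1 - μ`,
are searchers), a search cost `c > 0`, and an upper bound `M` on prices, the valuation of the
buyers. -/
structure StahlModel where
  n : ℕ
  two_le_n : 2 ≤ n
  μ : ℝ
  μ_pos : 0 < μ
  μ_lt_one : μ < 1
  c : ℝ
  c_pos : 0 < c
  M : ℝ

namespace StahlModel

/-- The cheapest stores of a set `S` of stores, at the prices `x`. -/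
def cheapest {n : ℕ} (S : Finset (Fin n)) (x : Fin n → ℝ) : Finset (Fin n) :=
  S.filter fun i => ∀ j ∈ S, x i ≤ x j

/-- The probability that a buyer buys in store `i`, if she buys at the cheapest store of `S` and
randomizes uniformly in case of a draw. -/
def share {n : ℕ} (S : Finset (Fin n)) (x : Fin n → ℝ) (i : Fin n) : ℝ :=
  if i ∈ cheapest S x then 1 / ((cheapest S x).card : ℝ) else 0

/-- The stores visited by a searcher with reserve price `PM` who would go through the stores in the
order `σ 0, σ 1, …` and who stops as soon as she sees a price `≤ PM`: a store is visited if and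
only if all the stores that come before it have prices above `PM`. -/
def visited {n : ℕ} (PM : ℝ) (x : Fin n → ℝ) (σ : Equiv.Perm (Fin n)) : Finset (Fin n) :=
  Finset.univ.filter fun i => ∀ j, σ.symm j < σ.symm i → PM < x j

variable (m : StahlModel)

/-- The quantity sold by seller `i` when the realized prices are `x` and the reserve price is `PM`.
Shoppers buy at the cheapest store. Each searcher goes through the stores in a uniformly random
order until she is satisfied, and then buys at the cheapest store that she has visited. -/
def quantity (PM : ℝ) (x : Fin m.n → ℝ) (i : Fin m.n) : ℝ :=
  m.μ * share Finset.univ x i +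
    (1 - m.μ) * ((∑ σ : Equiv.Perm (Fin m.n), share (visited PM x σ) x i) / (m.n ! : ℝ))

/-- The expected profit of seller `i` when the sellers use the (independent) mixed strategies `F`
and the searchers use the reserve price `PM`. -/
def profit (PM : ℝ) (F : Fin m.n → ProbabilityMeasure ℝ) (i : Fin m.n) : ℝ :=
  ∫ x, x i * m.quantity PM x i ∂(Measure.pi fun j => (F j : Measure ℝ))

/-- A (pure or mixed) pricing strategy: a distribution of prices in `[0, M]`. -/
def IsStrategy (s : ProbabilityMeasure ℝ) : Prop :=
  ∀ᵐ p ∂(s : Measure ℝ), p ∈ Icc 0 m.M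

/-- The law of the sequence of prices that a searcher would observe by visiting all the stores in a
uniformly random order. It depends only on how many sellers use each strategy. -/
def observedLaw {n : ℕ} (F : Fin n → ProbabilityMeasure ℝ) : Measure (Fin n → ℝ) :=
  ((n ! : ℕ) : ℝ≥0∞)⁻¹ •
    ∑ σ : Equiv.Perm (Fin n), Measure.pi fun k => (F (σ k) : Measure ℝ)

/-- The expected price in the next store `k + 1` for a searcher who knows how many sellers use each
strategy, but not who they are, and who updates her beliefs by Bayes' rule from the prices
`y 0, …, y k` that she has observed so far. -/
def expectedNext {n : ℕ} (F : Fin n → ProbabilityMeasure ℝ) (k : Fin n) (hk : (k : ℕ) + 1 < n) :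
    (Fin n → ℝ) → ℝ :=
  condExp (Filtration.piLE (X := fun _ : Fin n => ℝ) k) (observedLaw F)
    fun y => y ⟨(k : ℕ) + 1, hk⟩

/-- The reserve price `PM` is rational for the searchers, whose beliefs coincide with the actual
strategies `F`: whenever the searcher, having been unsatisfied with `y 0, …, y (k - 1)`, observes
`y k` and there is a further store to visit, then
* if `y k ≤ PM` (she stops), the expected price in a further search is not more than `c` lower than
  the lowest observed price, which is `y k`;
* if `y k > PM` (she goes on), the expected price in a further search is at least `c` lower than
  the lowest observed price. -/
def ReserveRational (PM : ℝ) (F : Fin m.n → ProbabilityMeasure ℝ) : Prop :=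
  ∀ (k : Fin m.n) (hk : (k : ℕ) + 1 < m.n), ∀ᵐ y ∂(observedLaw F),
    (∀ j < k, PM < y j) →
      (y k ≤ PM → y k ≤ expectedNext F k hk y + m.c) ∧
      (PM < y k → ∀ j ≤ k, expectedNext F k hk y + m.c ≤ y j)

/-- Nash equilibrium with a reserve price `PM`. The reserve price is one of the possible prices, and
the searchers accept any price below the search cost. -/
structure IsNash (PM : ℝ) (F : Fin m.n → ProbabilityMeasure ℝ) : Prop where
  reserve_le : PM ≤ m.M
  accept_below_cost : ∀ p < m.c, p ≤ PM
  isStrategy : ∀ i, m.IsStrategy (F i)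
  reserve_rational : m.ReserveRational PM F
  seller_optimal : ∀ (i : Fin m.n) (s : ProbabilityMeasure ℝ), m.IsStrategy s →
    m.profit PM (Function.update F i s) i ≤ m.profit PM F i

/-- The price `P_L`, the solution of `P_L (μ + (1 - μ) / n) = P_M (1 - μ) / n`. -/
def lowPrice (PM : ℝ) : ℝ :=
  PM * ((1 - m.μ) / (((m.n : ℝ) - 1) * m.μ + 1))

theorem lowPrice_eq (PM : ℝ) :
    m.lowPrice PM * (m.μ + (1 - m.μ) / m.n) = PM * ((1 - m.μ) / m.n) := by
  have h2 : (2 : ℝ) ≤ m.n := by exact_mod_cast m.two_le_n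
  have h0 : (m.n : ℝ) ≠ 0 := by positivity
  have h1 : ((m.n : ℝ) - 1) * m.μ + 1 ≠ 0 := by
    have := mul_pos (show (0 : ℝ) < (m.n : ℝ) - 1 by linarith) m.μ_pos
    positivity
  have h3 : m.μ + (1 - m.μ) / m.n = (((m.n : ℝ) - 1) * m.μ + 1) / m.n := by
    rw [eq_div_iff h0, add_mul, div_mul_cancel₀ _ h0]
    ring
  rw [lowPrice, h3, mul_assoc, div_mul_div_cancel₀ h1]

/-- The strategy `s` has the cutoff price `p`: its support consists of the nondegenerate interval
from `P_L` to `p < P_M` and of `P_M`, where it has a mass point. -/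
def HasCutoff (PM : ℝ) (s : ProbabilityMeasure ℝ) (p : ℝ) : Prop :=
  m.lowPrice PM < p ∧ p < PM ∧
    (s : Measure ℝ).support = Icc (m.lowPrice PM) p ∪ {PM} ∧ 0 < (s : Measure ℝ) {PM}

end StahlModel

end

/-! Write `S_i p` for the probability that seller `i` prices at or above `p` (`upperTail`) and `B_i
p` for the product of `S_j p` over the rivals `j ≠ i` (`rivalTail`). By charging slightly less than
`p ≤ P_M`, seller `i` secures a profit arbitrarily close to `p (α + μ B_i p)` with `α = (1 - μ) /
n`. In equilibrium this is a bound on the profit, attained at almost every price of `i`.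

Nobody prices above `P_M` (`ae_le_reserve`): such a price sells only if all rivals are at least as
expensive, which would have to happen with probability bounded below at every such price. At the top
of these prices all sellers would then have a common mass point, which undercutting destroys. The
same argument (`measure_Ioi_eq_zero_of_rivalTail_ge`) shows that profits do not exceed `P_M α`
(`profit_eq`), once they are known to be equal (`profit_le_profit`). Hence `B_i ≤ h` on `[P_L,
P_M]`, with equality almost surely, where `h` solves `p (α + μ h p) = P_M α` and falls strictly from
1 to 0. This is `TailEquilibrium`.

The rest is a study of "tight" prices, those with `B_i p = h p`. Because `S_i B_i` is the same
product for all `i`, a tight seller has the smallest `S_i`, and sellers tight at the same price have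
equal tails. There are no mass points below `P_M`, every price in `[P_L, P_M)` is tight for someone,
and tightness passes to lower prices (`tight_mono`). So each seller is either tight on all of `[P_L,
P_M)`, and all such sellers share one distribution, or is tight up to a cutoff, follows that
distribution up to it and puts the remaining mass at `P_M`. At least two sellers are of the first
kind, since a single seller pricing near `P_M` would face a constant `B_i` but a decreasing `h`. -/

namespace StahlModel

open Filter Topology

/-! ### Upper tails of price distributions. -/

section Tails

/-- The probability `ν [p, ∞)` of a price of at least `p`. -/
noncomputable def upperTail (ν : Measure ℝ) (p : ℝ) : ℝ := ν.real (Ici p)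

/-- The probability that all prices except that of `i` are at least `p`. -/
noncomputable def rivalTail {ι : Type*} [Fintype ι] [DecidableEq ι] (F : ι → Measure ℝ) (i : ι)
    (p : ℝ) : ℝ :=
  ∏ j ∈ Finset.univ.erase i, upperTail (F j) p

variable {ν : Measure ℝ} {p q : ℝ}

theorem upperTail_nonneg : 0 ≤ upperTail ν p := measureReal_nonneg

theorem of_ae_of_singleton {P : ℝ → Prop} (hP : ∀ᵐ p ∂ν, P p) (h : ν {p} ≠ 0) : P p := by
  by_contra hp
  exact h (measure_mono_null (by simpa using hp) (ae_iff.1 hP))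

theorem measure_eq_zero_of_ae {P : ℝ → Prop} {A : Set ℝ} (hP : ∀ᵐ p ∂ν, P p)
    (h : ∀ p ∈ A, ¬ P p) : ν A = 0 :=
  measure_mono_null h (ae_iff.1 hP)

variable [IsProbabilityMeasure ν]

theorem upperTail_le_one : upperTail ν p ≤ 1 := measureReal_le_one

theorem upperTail_antitone : Antitone (upperTail ν) := fun _ _ h =>
  measureReal_mono (Ici_subset_Ici.2 h)

theorem upperTail_eq_add (h : p ≤ q) : upperTail ν p = ν.real (Ico p q) + upperTail ν q := by
  rw [upperTail, upperTail, ← measureReal_union _ measurableSet_Ici, Ico_union_Ici_eq_Ici h]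
  exact Set.disjoint_left.2 fun x hx hx' => not_lt.2 hx' hx.2

theorem upperTail_eq_of_Ico (h : p ≤ q) (h0 : ν (Ico p q) = 0) :
    upperTail ν p = upperTail ν q := by
  rw [upperTail_eq_add h, measureReal_def, h0]; simp

theorem upperTail_eq_singleton_add : upperTail ν p = ν.real {p} + ν.real (Ioi p) := by
  rw [upperTail, ← measureReal_union _ measurableSet_Ioi]
  · congr 1; ext x; simp [le_iff_eq_or_lt]
  · simp

theorem upperTail_eq_one_sub : upperTail ν p = 1 - ν.real (Iio p) := by
  rw [upperTail, ← compl_Iio, measureReal_compl measurableSet_Iio]; simp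

theorem real_Ioi_eq_one_sub : ν.real (Ioi p) = 1 - ν.real (Iic p) := by
  rw [← compl_Iic, measureReal_compl measurableSet_Iic]; simp

theorem tendsto_upperTail_right :
    Tendsto (upperTail ν) (𝓝[>] p) (𝓝 (ν.real (Ioi p))) := by
  have h := tendsto_measure_biInter_gt (μ := ν) (s := fun q : ℝ => Iio q) (a := p)
    (fun _ _ => measurableSet_Iio.nullMeasurableSet) (fun _ _ _ h => Iio_subset_Iio h)
    ⟨p + 1, by simp, measure_ne_top _ _⟩
  have hs : (⋂ r > p, Iio r) = Iic p := by
    ext x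
    simp only [mem_iInter, mem_Iio, mem_Iic]
    exact ⟨fun h => le_of_forall_gt h, fun h r hr => lt_of_le_of_lt h hr⟩
  rw [hs] at h
  have h2 := (ENNReal.tendsto_toReal (measure_ne_top ν (Iic p))).comp h
  rw [real_Ioi_eq_one_sub]
  refine (h2.const_sub 1).congr fun q => ?_
  rw [upperTail_eq_one_sub]; rfl

theorem tendsto_upperTail_left :
    Tendsto (upperTail ν) (𝓝[<] p) (𝓝 (upperTail ν p)) := by
  have h := tendsto_measure_biInter_gt (μ := ν) (ι := ℝᵒᵈ)
    (s := fun q => Ici (OrderDual.ofDual q)) (a := OrderDual.toDual p)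
    (fun _ _ => measurableSet_Ici.nullMeasurableSet) (fun _ _ _ h => Ici_subset_Ici.2 h)
    ⟨OrderDual.toDual (p - 1), OrderDual.toDual_lt_toDual.2 (by linarith), measure_ne_top _ _⟩
  have hs : (⋂ r > OrderDual.toDual p, Ici (OrderDual.ofDual r)) = Ici p := by
    ext x
    simp only [mem_iInter, mem_Ici]
    refine ⟨fun h => le_of_forall_lt fun c hc => ?_, fun h r hr => (le_of_lt (OrderDual.toDual_lt_toDual.1 hr)).trans h⟩
    obtain ⟨d, hd, hd'⟩ := exists_between hc
    exact hd.trans_le (h (OrderDual.toDual d) hd')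
  rw [hs] at h
  exact (ENNReal.tendsto_toReal (measure_ne_top ν (Ici p))).comp h

theorem continuousAt_upperTail (h : ν {p} = 0) : ContinuousAt (upperTail ν) p := by
  rw [continuousAt_iff_continuous_left'_right']
  refine ⟨tendsto_upperTail_left, ?_⟩
  have := tendsto_upperTail_right (ν := ν) (p := p)
  rwa [show ν.real (Ioi p) = upperTail ν p by
    rw [upperTail_eq_singleton_add, measureReal_def ν {p}, h]; simp] at this

theorem cdf_eq_one_sub_upperTail (h : ν {p} = 0) : cdf ν p = 1 - upperTail ν p := by
  rw [upperTail_eq_singleton_add, real_Ioi_eq_one_sub, cdf_eq_real, measureReal_def ν {p}, h]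
  simp

/-- With positive probability the price has a small probability of being undercut. -/
theorem exists_upperTail_gt {P : ℝ → Prop} (hP : ∀ᵐ p ∂ν, P p) {ε : ℝ} (hε : 0 < ε) :
    ∃ p, P p ∧ 1 - ε < upperTail ν p := by
  by_contra! hcon
  have hz : ν {p | 1 - ε < upperTail ν p} = 0 := by
    refine measure_mono_null ?_ (ae_iff.1 hP)
    intro p hp hPp
    exact not_le.2 hp (hcon p hPp)
  -- `A` is a lower set. If it is null and bounded, then its supremum belongs to it, and right
  -- limits show that it extends further.
  set A := {p | 1 - ε < upperTail ν p} with hA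
  have hbot : ∃ p, p ∈ A := by
    have h1 : Tendsto (fun p => 1 - cdf ν p) atBot (𝓝 (1 - 0)) :=
      (tendsto_cdf_atBot ν).const_sub 1
    obtain ⟨p, hp⟩ := (h1.eventually (lt_mem_nhds (show 1 - ε < 1 - 0 by linarith))).exists
    refine ⟨p, ?_⟩
    have : ν.real (Iio p) ≤ ν.real (Iic p) := measureReal_mono Iio_subset_Iic_self
    simp only [hA, mem_ofPred_eq, upperTail_eq_one_sub]
    rw [cdf_eq_real] at hp
    linarith
  obtain ⟨a, ha⟩ := hbot
  have hAl : ∀ x y, x ≤ y → y ∈ A → x ∈ A := fun x y h hy => lt_of_lt_of_le hy (upperTail_antitone h)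
  by_cases hbd : BddAbove A
  · set s := sSup A
    have hs : Iio s ⊆ A := by
      intro x hx
      obtain ⟨y, hy, hxy⟩ := exists_lt_of_lt_csSup ⟨a, ha⟩ hx
      exact hAl _ _ hxy.le hy
    have hs1 : upperTail ν s = 1 := by
      rw [upperTail_eq_one_sub, measureReal_def, measure_mono_null hs hz]; simp
    have hsA : s ∈ A := by
      simp only [hA, mem_ofPred_eq, hs1]; linarith
    have hs2 : ν (Iic s) = 0 := measure_mono_null (fun x hx => hAl _ _ hx hsA) hz
    have hlim := tendsto_upperTail_right (ν := ν) (p := s)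
    rw [real_Ioi_eq_one_sub, measureReal_def, hs2] at hlim
    have hlim' := hlim.eventually (lt_mem_nhds (show 1 - ε < 1 - (0 : ℝ≥0∞).toReal by simpa using hε))
    obtain ⟨y, hy, hys⟩ := (hlim'.and self_mem_nhdsWithin).exists
    exact not_le.2 hys (le_csSup hbd hy)
  · have : A = univ := by
      rw [not_bddAbove_iff] at hbd
      ext x
      obtain ⟨y, hy, hxy⟩ := hbd x
      simp [hAl _ _ hxy.le hy]
    rw [this] at hz
    simp at hz

/-- A strict fall of the tail from `x` to `y` is mass in `[x, y)`, for `y` as close to `x` as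
desired. The endpoints follow because supports are closed. -/
theorem Icc_subset_support {a c : ℝ} (hac : a < c) (hanti : StrictAntiOn (upperTail ν) (Ico a c)) :
    Icc a c ⊆ ν.support := by
  have hIoo : Ioo a c ⊆ ν.support := by
    intro x hx
    rw [Measure.mem_support_iff_forall]
    intro U hU
    obtain ⟨l, u, hxlu, hlu⟩ := (mem_nhds_iff_exists_Ioo_subset' ⟨a, hx.1⟩ ⟨c, hx.2⟩).1 hU
    obtain ⟨y, hxy, hy⟩ := exists_between (lt_min hxlu.2 hx.2)
    have hlt := hanti ⟨hx.1.le, hx.2⟩ ⟨hx.1.le.trans hxy.le, hy.trans_le (min_le_right _ _)⟩ hxy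
    rw [upperTail_eq_add hxy.le] at hlt
    have hpos : 0 < ν.real (Ico x y) := by linarith
    rw [measureReal_def, ENNReal.toReal_pos_iff] at hpos
    refine hpos.1.trans_le (measure_mono fun z hz => hlu ?_)
    exact ⟨hxlu.1.trans_le hz.1, hz.2.trans (hy.trans_le (min_le_left _ _))⟩
  rw [← closure_Ioo hac.ne]
  exact closure_minimal hIoo Measure.isClosed_support

variable {ι : Type*} [Fintype ι] [DecidableEq ι] {F : ι → Measure ℝ}

theorem rivalTail_nonneg {i : ι} : 0 ≤ rivalTail F i p :=
  Finset.prod_nonneg fun _ _ => upperTail_nonneg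

/-- The right-hand side does not depend on `i`, which makes different sellers comparable at a given
price. -/
theorem upperTail_mul_rivalTail (i : ι) :
    upperTail (F i) p * rivalTail F i p = ∏ j, upperTail (F j) p :=
  Finset.mul_prod_erase _ (fun j => upperTail (F j) p) (Finset.mem_univ i)

variable [∀ i, IsProbabilityMeasure (F i)]

theorem rivalTail_le_one {i : ι} : rivalTail F i p ≤ 1 :=
  Finset.prod_le_one (fun _ _ => upperTail_nonneg) fun _ _ => upperTail_le_one

theorem rivalTail_le_upperTail {i j : ι} (h : j ≠ i) : rivalTail F i p ≤ upperTail (F j) p := by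
  rw [rivalTail, ← Finset.mul_prod_erase _ _ (Finset.mem_erase.2 ⟨h, Finset.mem_univ j⟩)]
  exact mul_le_of_le_one_right upperTail_nonneg
    (Finset.prod_le_one (fun _ _ => upperTail_nonneg) fun _ _ => upperTail_le_one)

/-- If nobody prices above `t` unless the rivals price higher with a probability bounded below, and
the sellers have no common mass point above `t`, then nobody prices above `t`. -/
theorem measure_Ioi_eq_zero_of_rivalTail_ge [Nontrivial ι] {t δ : ℝ} (hδ : 0 < δ)
    (hB : ∀ i, ∀ᵐ p ∂(F i), t < p → δ ≤ rivalTail F i p)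
    (hcommon : ∀ p, t < p → ∃ i, F i {p} = 0) (i : ι) : F i (Ioi t) = 0 := by
  by_contra hi
  obtain ⟨j, hji⟩ := exists_ne i
  obtain ⟨p₁, hp₁, hδ₁⟩ : ∃ p, t < p ∧ δ ≤ rivalTail F i p := by
    by_contra! hcon
    exact hi (measure_eq_zero_of_ae (hB i) fun p hp h => not_le.2 (hcon p hp) (h hp))
  -- The supremum `s` of `A` bounds the prices of the rivals of `j`, since `B_k ≤ S_j` for `k ≠ j`.
  -- Then `j` cannot price above `s` either, because `B_j` vanishes there.
  set A := {p | δ ≤ upperTail (F j) p} with hA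
  have hp₁A : p₁ ∈ A := hδ₁.trans (rivalTail_le_upperTail hji)
  have hbd : BddAbove A := by
    obtain ⟨b, hb⟩ := ((tendsto_cdf_atTop (F j)).eventually
      (lt_mem_nhds (show 1 - δ < 1 by linarith))).exists
    refine ⟨b + 1, fun p hp => ?_⟩
    by_contra! hbp
    have h1 : (F j).real (Iic b) ≤ (F j).real (Iio p) :=
      measureReal_mono (fun x hx => lt_of_le_of_lt (mem_Iic.1 hx) (by linarith))
    simp only [hA, mem_ofPred_eq, upperTail_eq_one_sub] at hp
    rw [cdf_eq_real] at hb
    linarith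
  set s := sSup A
  have hts : t < s := hp₁.trans_le (le_csSup hbd hp₁A)
  have hsA : δ ≤ upperTail (F j) s := by
    refine ge_of_tendsto tendsto_upperTail_left ?_
    filter_upwards [self_mem_nhdsWithin] with x hx
    obtain ⟨y, hy, hxy⟩ := exists_lt_of_lt_csSup ⟨p₁, hp₁A⟩ hx
    exact le_trans hy (upperTail_antitone hxy.le)
  have hne : ∀ k, k ≠ j → F k (Ioi s) = 0 := fun k hk =>
    measure_eq_zero_of_ae (hB k) fun p hp h => not_le.2 hp
      (le_csSup hbd ((h (hts.trans hp)).trans (rivalTail_le_upperTail hk.symm)))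
  have hj : F j (Ioi s) = 0 := by
    refine measure_eq_zero_of_ae (hB j) fun p hp h => ?_
    have h1 := (h (hts.trans hp)).trans (rivalTail_le_upperTail hji.symm)
    rw [upperTail, measureReal_def,
      show F i (Ici p) = 0 from
        measure_mono_null (Ici_subset_Ioi.2 hp) (hne i hji.symm)] at h1
    exact not_le.2 hδ (by simpa using h1)
  have key : ∀ k, F k (Ioi s) = 0 → δ ≤ upperTail (F k) s → F k {s} ≠ 0 := by
    intro k hk h1 h0
    rw [upperTail_eq_singleton_add, measureReal_def, measureReal_def, hk, h0] at h1
    exact not_le.2 hδ (by simpa using h1)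
  -- Since `S_j s ≥ δ` and nothing lies above `s`, seller `j` has a mass point at `s`. So `s` is a
  -- price of `j`, which forces `S_k s ≥ δ` and a mass point at `s` for every rival `k` too.
  have hj' := key j hj hsA
  obtain ⟨k, hk⟩ := hcommon s hts
  have hkj : k ≠ j := fun h => hj' (h ▸ hk)
  exact key k (hne k hkj)
    ((of_ae_of_singleton (hB j) hj' hts).trans (rivalTail_le_upperTail hkj)) hk

end Tails

/-! ### Structure of the solutions of the tail conditions. -/

/-- The conditions that characterize the equilibria in which the prices belong to `[a, b]`: the
probability `h p` with which the rivals have to price above `p` in order to make the price `p`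
optimal is attained almost surely and never exceeded, and common mass points are excluded. -/
structure TailEquilibrium {ι : Type*} [Fintype ι] [DecidableEq ι] (F : ι → Measure ℝ) (h : ℝ → ℝ)
    (a b : ℝ) : Prop where
  lt : a < b
  continuousAt : ∀ p ∈ Icc a b, ContinuousAt h p
  strictAntiOn : StrictAntiOn h (Icc a b)
  left_eq : h a = 1
  right_eq : h b = 0
  mem : ∀ i, ∀ᵐ p ∂(F i), p ∈ Icc a b
  le : ∀ i, ∀ p ∈ Icc a b, rivalTail F i p ≤ h p
  ae_eq : ∀ i, ∀ᵐ p ∂(F i), rivalTail F i p = h p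
  tie : ∀ i j, i ≠ j → ∀ p, F i {p} ≠ 0 → F j {p} ≠ 0 → rivalTail F i p = 0

namespace TailEquilibrium

variable {ι : Type*} [Fintype ι] [DecidableEq ι] {F : ι → Measure ℝ} {h : ℝ → ℝ} {a b : ℝ}
  (H : TailEquilibrium F h a b) {p q : ℝ} {i j : ι}

include H

theorem pos (hp : p ∈ Ico a b) : 0 < h p := by
  rw [← H.right_eq]
  exact H.strictAntiOn ⟨hp.1, hp.2.le⟩ ⟨H.lt.le, le_rfl⟩ hp.2

/-- In `S_i B_i = S_j B_j` the factor `B_i = h` is the largest possible, so `S_i` is the smallest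
tail. -/
theorem upperTail_le_of_tight (hp : p ∈ Ico a b) (hi : rivalTail F i p = h p) (j : ι) :
    upperTail (F i) p ≤ upperTail (F j) p := by
  have h1 := H.le j p ⟨hp.1, hp.2.le⟩
  have h2 : upperTail (F i) p * rivalTail F i p = upperTail (F j) p * rivalTail F j p := by
    rw [upperTail_mul_rivalTail, upperTail_mul_rivalTail]
  rw [hi] at h2
  have h3 : upperTail (F j) p * rivalTail F j p ≤ upperTail (F j) p * h p :=
    mul_le_mul_of_nonneg_left h1 upperTail_nonneg
  exact le_of_mul_le_mul_right (h2.trans_le h3) (H.pos hp)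

theorem upperTail_eq_zero (hp : b < p) : upperTail (F i) p = 0 := by
  have h0 : F i (Ici p) = 0 :=
    measure_eq_zero_of_ae (H.mem i) fun x hx hm => not_lt.2 hm.2 (lt_of_lt_of_le hp hx)
  rw [upperTail, measureReal_def, h0]
  simp

theorem upperTail_eq_of_tight (hp : p ∈ Ico a b) (hi : rivalTail F i p = h p)
    (hj : rivalTail F j p = h p) : upperTail (F i) p = upperTail (F j) p :=
  le_antisymm (H.upperTail_le_of_tight hp hi j) (H.upperTail_le_of_tight hp hj i)

variable [∀ i, IsProbabilityMeasure (F i)]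

theorem upperTail_eq_one (hp : p ≤ a) : upperTail (F i) p = 1 := by
  have h0 : F i (Iio p) = 0 :=
    measure_eq_zero_of_ae (H.mem i) fun x hx hm => not_lt.2 hm.1 (lt_of_lt_of_le hx hp)
  rw [upperTail_eq_one_sub, measureReal_def, h0]
  simp

theorem rivalTail_eq_one (hp : p ≤ a) : rivalTail F i p = 1 :=
  Finset.prod_eq_one fun _ _ => H.upperTail_eq_one hp

theorem rivalTail_left : rivalTail F i a = h a := by
  rw [H.rivalTail_eq_one le_rfl, H.left_eq]

/-- Only `b` can be a mass point. -/
theorem singleton_eq_zero (hp : p < b) : F i {p} = 0 := by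
  by_contra hi
  have hpa : a ≤ p := (of_ae_of_singleton (H.mem i) hi).1
  have hpos := H.pos ⟨hpa, hp⟩
  have hBi := of_ae_of_singleton (H.ae_eq i) hi
  have hj0 : ∀ j, j ≠ i → F j {p} = 0 := fun j hj => by
    by_contra hc
    exact hpos.ne' (hBi ▸ H.tie i j hj.symm p hi hc)
  -- The mass point of `i` makes `B_j` jump down at `p` (or `B_j` vanishes just above `p`), so
  -- prices just above `p` are not optimal for any rival `j`.
  have hlt : ∀ j ∈ Finset.univ.erase i, ∀ᶠ q in 𝓝[>] p, rivalTail F j q < h q := by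
    intro j hj
    have hji := Finset.ne_of_mem_erase hj
    have hlim : Tendsto (rivalTail F j) (𝓝[>] p)
        (𝓝 (∏ k ∈ Finset.univ.erase j, (F k).real (Ioi p))) :=
      tendsto_finsetProd _ fun k _ => tendsto_upperTail_right
    have hlimh : Tendsto h (𝓝[>] p) (𝓝 (h p)) :=
      (H.continuousAt p ⟨hpa, hp.le⟩).tendsto.mono_left nhdsWithin_le_nhds
    refine hlim.eventually_lt hlimh ?_
    have hmem : i ∈ Finset.univ.erase j := Finset.mem_erase.2 ⟨hji.symm, Finset.mem_univ i⟩
    have hle := H.le j p ⟨hpa, hp.le⟩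
    rw [rivalTail, ← Finset.mul_prod_erase _ _ hmem] at hle
    rw [← Finset.mul_prod_erase _ _ hmem]
    have hC : ∏ k ∈ (Finset.univ.erase j).erase i, (F k).real (Ioi p) =
        ∏ k ∈ (Finset.univ.erase j).erase i, upperTail (F k) p := by
      refine Finset.prod_congr rfl fun k hk => ?_
      rw [upperTail_eq_singleton_add, measureReal_def (F k) {p},
        hj0 k (Finset.ne_of_mem_erase hk)]
      simp
    rw [hC]
    set C := ∏ k ∈ (Finset.univ.erase j).erase i, upperTail (F k) p
    have hC0 : 0 ≤ C := Finset.prod_nonneg fun _ _ => upperTail_nonneg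
    have hs := upperTail_eq_singleton_add (ν := F i) (p := p)
    have hs0 : 0 < (F i).real {p} := ENNReal.toReal_pos hi (measure_ne_top _ _)
    rcases hC0.eq_or_lt with h0 | h0
    · rw [← h0]; simpa using hpos
    · nlinarith
  have hev := (Filter.eventually_all_finset _).2 hlt
  obtain ⟨r, hr, hr'⟩ := (mem_nhdsGT_iff_exists_Ioo_subset (α := ℝ)).1 hev
  obtain ⟨q, hpq, hq⟩ := exists_between (lt_min hr hp)
  have hqr : q < r := hq.trans_le (min_le_left _ _)
  have hqb : q < b := hq.trans_le (min_le_right _ _)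
  -- Without rivals in `[p, q)`, `B_i` stays at `h p > h q`, against `H.le`.
  have hS : rivalTail F i p = rivalTail F i q := by
    refine Finset.prod_congr rfl fun j hj => upperTail_eq_of_Ico hpq.le ?_
    have h1 : F j (Ioo p q) = 0 := measure_eq_zero_of_ae (H.ae_eq j) fun x hx he =>
      (hr' (⟨hx.1, hx.2.trans hqr⟩ : x ∈ Ioo p r) j hj).ne he
    rw [← Ioo_insert_left hpq, ← singleton_union]
    exact measure_union_null (hj0 j (Finset.ne_of_mem_erase hj)) h1
  have h1 := H.le i q ⟨hpa.trans hpq.le, hqb.le⟩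
  have h2 := H.strictAntiOn ⟨hpa, hp.le⟩ ⟨hpa.trans hpq.le, hqb.le⟩ hpq
  linarith

theorem continuousAt_upperTail (hp : p < b) : ContinuousAt (upperTail (F i)) p :=
  StahlModel.continuousAt_upperTail (H.singleton_eq_zero hp)

theorem continuousAt_rivalTail (hp : p < b) : ContinuousAt (rivalTail F i) p :=
  tendsto_finsetProd _ fun _ _ => H.continuousAt_upperTail hp

theorem upperTail_eq_of_Ioo (hpq : p ≤ q) (hq : q ≤ b) (h0 : F i (Ioo p q) = 0) :
    upperTail (F i) p = upperTail (F i) q := by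
  rcases hpq.eq_or_lt with rfl | hpq
  · rfl
  refine upperTail_eq_of_Ico hpq.le ?_
  rw [← Ioo_insert_left hpq, ← singleton_union]
  exact measure_union_null (H.singleton_eq_zero (hpq.trans_le hq)) h0

/-- A seller's upper tail is constant where prices are not optimal for the seller. -/
theorem upperTail_eq_of_ne (hpq : p ≤ q) (hq : q ≤ b)
    (hne : ∀ x ∈ Ioo p q, rivalTail F i x ≠ h x) : upperTail (F i) p = upperTail (F i) q :=
  H.upperTail_eq_of_Ioo hpq hq (measure_eq_zero_of_ae (H.ae_eq i) hne)

theorem isCompact_tight (i : ι) (hq : q < b) (hp : a ≤ p) :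
    IsCompact {x ∈ Icc p q | rivalTail F i x = h x} := by
  refine isCompact_Icc.of_isClosed_subset ?_ (fun x hx => hx.1)
  have hc : ContinuousOn (fun x => rivalTail F i x - h x) (Icc p q) := fun x hx =>
    ((H.continuousAt_rivalTail (hx.2.trans_lt hq)).sub
      (H.continuousAt x ⟨hp.trans hx.1, (hx.2.trans_lt hq).le⟩)).continuousWithinAt
  convert hc.preimage_isClosed_of_isClosed isClosed_Icc (isClosed_singleton (x := 0)) using 1
  ext x
  simp [sub_eq_zero]

/-- There are no gaps: every price in `[a, b)` is optimal for some seller. -/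
theorem exists_tight [Nonempty ι] (hp : p ∈ Ico a b) : ∃ i, rivalTail F i p = h p := by
  by_contra! hcon
  have hcpt : IsCompact (⋃ i, {x ∈ Icc a p | rivalTail F i x = h x}) :=
    isCompact_iUnion fun i => H.isCompact_tight i hp.2 le_rfl
  -- Beyond the last tight price `q` nobody prices up to `p`, so all tails stay constant while `h`
  -- falls.
  obtain ⟨q, hq, hmax⟩ := hcpt.exists_isGreatest
    ⟨a, mem_iUnion.2 ⟨Classical.arbitrary ι, ⟨le_rfl, hp.1⟩, H.rivalTail_left⟩⟩
  obtain ⟨i, hqm, hqi⟩ := mem_iUnion.1 hq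
  have hqp : q < p := lt_of_le_of_ne hqm.2 fun h => hcon i (h ▸ hqi)
  have hB : rivalTail F i q = rivalTail F i p :=
    Finset.prod_congr rfl fun j _ => H.upperTail_eq_of_ne hqp.le hp.2.le fun x hx he =>
      not_le.2 hx.1 (hmax (mem_iUnion.2 ⟨j, ⟨hqm.1.trans hx.1.le, hx.2.le⟩, he⟩))
  have h1 := H.le i p ⟨hp.1, hp.2.le⟩
  have h2 := H.strictAntiOn ⟨hqm.1, hqm.2.trans hp.2.le⟩ ⟨hp.1, hp.2.le⟩ hqp
  linarith

/-- It is impossible that only one seller finds prices close to `b` optimal. -/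
theorem exists_ne_tight_of_forall [Nonempty ι] (hp : p ∈ Ico a b) (i : ι) :
    ∃ q ∈ Ico p b, ∃ j, j ≠ i ∧ rivalTail F j q = h q := by
  by_contra! hcon
  obtain ⟨q, hpq, hqb⟩ := exists_between hp.2
  -- With no gaps, `i` must be tight on all of `[p, b)`. But `B_i` is constant there, as no rival
  -- prices there.
  have ht : ∀ x ∈ Ico p b, rivalTail F i x = h x := fun x hx => by
    obtain ⟨j, hj⟩ := H.exists_tight ⟨hp.1.trans hx.1, hx.2⟩
    rcases eq_or_ne j i with rfl | hji
    · exact hj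
    · exact absurd hj (hcon x hx j hji)
  have hB : rivalTail F i p = rivalTail F i q :=
    Finset.prod_congr rfl fun j hj => H.upperTail_eq_of_ne hpq.le hqb.le fun x hx =>
      hcon x ⟨hx.1.le, hx.2.trans hqb⟩ j (Finset.ne_of_mem_erase hj)
  rw [ht p ⟨le_rfl, hp.2⟩, ht q ⟨hpq.le, hqb⟩] at hB
  exact (H.strictAntiOn ⟨hp.1, hp.2.le⟩ ⟨hp.1.trans hpq.le, hqb.le⟩ hpq).ne' hB

/-- Some other seller `j` is tight at a price `q ≥ p`, and `0 < h q = B_j q ≤ S_i q ≤ S_i p`. -/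
theorem upperTail_pos [Nonempty ι] (hp : p ∈ Ico a b) : 0 < upperTail (F i) p := by
  refine upperTail_nonneg.lt_of_ne' fun h0 => ?_
  obtain ⟨q, hq, j, hji, hj⟩ := H.exists_ne_tight_of_forall hp i
  have h1 := rivalTail_le_upperTail (F := F) (p := q) hji.symm
  have h2 := upperTail_antitone (ν := F i) hq.1
  have h3 := H.pos ⟨hp.1.trans hq.1, hq.2⟩
  linarith

/-- Converse of `upperTail_le_of_tight`: a seller whose tail is as small as that of a tight seller
is tight. Positivity of the tail allows cancelling it from the common product. -/
theorem tight_of_upperTail_le [Nonempty ι] (hp : p ∈ Ico a b) (hj : rivalTail F j p = h p)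
    (hij : upperTail (F i) p ≤ upperTail (F j) p) : rivalTail F i p = h p := by
  have h2 : upperTail (F i) p * rivalTail F i p = upperTail (F j) p * rivalTail F j p := by
    rw [upperTail_mul_rivalTail, upperTail_mul_rivalTail]
  rw [le_antisymm hij (H.upperTail_le_of_tight hp hj i), hj] at h2
  exact mul_left_cancel₀ (H.upperTail_pos hp).ne' h2

/-- If a price is optimal for a seller, then so are all lower prices. -/
theorem tight_mono [Nonempty ι] (hp : p ∈ Ico a b) (hi : rivalTail F i p = h p) (hq : a ≤ q)
    (hqp : q ≤ p) : rivalTail F i q = h q := by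
  by_contra hcon
  obtain ⟨r, ⟨hrm, hr⟩, hmin⟩ :=
    (H.isCompact_tight i hp.2 hq).exists_isLeast ⟨p, ⟨hqp, le_rfl⟩, hi⟩
  have hrb : r < b := hrm.2.trans_lt hp.2
  have hS : upperTail (F i) q = upperTail (F i) r :=
    H.upperTail_eq_of_ne hrm.1 hrb.le fun x hx he =>
      not_le.2 hx.2 (hmin ⟨⟨hx.1.le, hx.2.le.trans hrm.2⟩, he⟩)
  have hqm : q ∈ Ico a b := ⟨hq, hqp.trans_lt hp.2⟩
  -- For `j` tight at `q` and `r` the next tight price of `i`, `S_i q = S_i r ≤ S_j r ≤ S_j q`, so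
  -- `i` is tight at `q` as well.
  obtain ⟨j, hj⟩ := H.exists_tight hqm
  have h1 := H.upperTail_le_of_tight ⟨hq.trans hrm.1, hrb⟩ hr j
  have h2 := upperTail_antitone (ν := F j) hrm.1
  exact hcon (H.tight_of_upperTail_le hqm hj (by linarith))

/-- Apart from any given seller there is one for whom all prices in `[a, b)` are optimal. -/
theorem exists_ne_forall_tight [Nonempty ι] (i : ι) :
    ∃ j, j ≠ i ∧ ∀ p ∈ Ico a b, rivalTail F j p = h p := by
  by_contra! hcon
  choose! P hP hPt using hcon
  obtain ⟨p, hp, hpP⟩ : ∃ p ∈ Ico a b, ∀ j, j ≠ i → P j ≤ p := by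
    have hne : (insert a ((Finset.univ.erase i).image P)).Nonempty := Finset.insert_nonempty _ _
    refine ⟨(insert a ((Finset.univ.erase i).image P)).max' hne, ?_,
      fun j hj => Finset.le_max' _ (P j) ?_⟩
    · have := Finset.max'_mem _ hne
      rcases Finset.mem_insert.1 this with h | h
      · rw [h]; exact ⟨le_rfl, H.lt⟩
      · obtain ⟨j, hj, hjP⟩ := Finset.mem_image.1 h
        rw [← hjP]; exact hP j (Finset.ne_of_mem_erase hj)
    · exact Finset.mem_insert_of_mem (Finset.mem_image_of_mem _ (by simpa using hj))
  obtain ⟨q, hq, j, hji, hj⟩ := H.exists_ne_tight_of_forall hp i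
  exact hPt j hji (H.tight_mono ⟨hp.1.trans hq.1, hq.2⟩ hj (hP j hji).1 ((hpP j hji).trans hq.1))

theorem eq_of_forall_tight (hi : ∀ p ∈ Ico a b, rivalTail F i p = h p)
    (hj : ∀ p ∈ Ico a b, rivalTail F j p = h p) : F i = F j := by
  have hlt : ∀ p < b, upperTail (F i) p = upperTail (F j) p := fun p hp => by
    rcases le_total p a with hpa | hpa
    · rw [H.upperTail_eq_one hpa, H.upperTail_eq_one hpa]
    · exact H.upperTail_eq_of_tight ⟨hpa, hp⟩ (hi p ⟨hpa, hp⟩) (hj p ⟨hpa, hp⟩)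
  have hall : ∀ p, upperTail (F i) p = upperTail (F j) p := fun p => by
    rcases lt_trichotomy p b with hp | rfl | hp
    · exact hlt p hp
    · refine tendsto_nhds_unique_of_eventuallyEq (tendsto_upperTail_left (ν := F i))
        (tendsto_upperTail_left (ν := F j)) ?_
      filter_upwards [self_mem_nhdsWithin] with x hx using hlt x hx
    · rw [H.upperTail_eq_zero hp, H.upperTail_eq_zero hp]
  refine Measure.ext_of_Ici _ _ fun p => ?_
  have := hall p
  rwa [upperTail, upperTail, measureReal_def, measureReal_def,
    ENNReal.toReal_eq_toReal_iff' (measure_ne_top _ _) (measure_ne_top _ _)] at this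

/-- A seller for whom all prices are optimal has no mass points. -/
theorem singleton_eq_zero_of_forall_tight [Nonempty ι]
    (hi : ∀ p ∈ Ico a b, rivalTail F i p = h p) (p : ℝ) : F i {p} = 0 := by
  rcases lt_trichotomy p b with hp | rfl | hp
  · exact H.singleton_eq_zero hp
  · have h0 : rivalTail F i p = 0 :=
      le_antisymm ((H.le i p ⟨H.lt.le, le_rfl⟩).trans_eq H.right_eq) rivalTail_nonneg
    obtain ⟨j, -, hj⟩ := Finset.prod_eq_zero_iff.1 h0
    -- At the right end, `h = 0` forces some rival tail to vanish. The tail of `i`, being the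
    -- smallest below this point, vanishes too by left continuity.
    have hle : upperTail (F i) p ≤ upperTail (F j) p := by
      refine le_of_tendsto_of_tendsto (tendsto_upperTail_left (ν := F i))
        (tendsto_upperTail_left (ν := F j)) ?_
      filter_upwards [Ioo_mem_nhdsLT H.lt] with x hx
      exact H.upperTail_le_of_tight ⟨hx.1.le, hx.2⟩ (hi x ⟨hx.1.le, hx.2⟩) j
    have h1 : upperTail (F i) p = 0 := le_antisymm (hle.trans_eq hj) upperTail_nonneg
    rw [upperTail, measureReal_eq_zero_iff] at h1
    exact measure_mono_null (by simp) h1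
  · exact measure_eq_zero_of_ae (H.mem i) fun x hx hm => by
      rw [mem_singleton_iff] at hx
      subst hx
      exact not_lt.2 hm.2 hp

/-- The cutoff price of a seller for whom not all prices are optimal. -/
theorem exists_cutoff [Nonempty ι] (hj : ¬ ∀ p ∈ Ico a b, rivalTail F j p = h p) :
    ∃ c ∈ Ico a b, rivalTail F j c = h c ∧ F j (Ioo c b) = 0 := by
  push Not at hj
  obtain ⟨z, hz, hzj⟩ := hj
  obtain ⟨c, ⟨hcm, hc⟩, hmax⟩ := (H.isCompact_tight j hz.2 le_rfl).exists_isGreatest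
    ⟨a, ⟨le_rfl, hz.1⟩, H.rivalTail_left⟩
  refine ⟨c, ⟨hcm.1, hcm.2.trans_lt hz.2⟩, hc, measure_eq_zero_of_ae (H.ae_eq j) fun x hx he => ?_⟩
  rcases le_total x z with hxz | hxz
  · exact not_le.2 hx.1 (hmax ⟨⟨hcm.1.trans hx.1.le, hxz⟩, he⟩)
  · exact hzj (H.tight_mono ⟨hz.1.trans hxz, hx.2⟩ he hz.1 hxz)

theorem upperTail_eq_of_le_of_tight [Nonempty ι] (hi : ∀ p ∈ Ico a b, rivalTail F i p = h p)
    {c : ℝ} (hc : c ∈ Ico a b) (hj : rivalTail F j c = h c) (hp : p ≤ c) :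
    upperTail (F j) p = upperTail (F i) p := by
  rcases le_total p a with hpa | hpa
  · rw [H.upperTail_eq_one hpa, H.upperTail_eq_one hpa]
  · have hpm : p ∈ Ico a b := ⟨hpa, hp.trans_lt hc.2⟩
    exact H.upperTail_eq_of_tight hpm (H.tight_mono hc hj hpa hp) (hi p hpm)

/-- Every other seller copies `S_i` up to a cutoff, or throughout, and has a constant tail after it.
So a flat piece of `S_i` would be flat for all rivals, hence for `B_i = h`. -/
theorem upperTail_strictAntiOn [Nonempty ι] (hi : ∀ p ∈ Ico a b, rivalTail F i p = h p) :
    StrictAntiOn (upperTail (F i)) (Ico a b) := by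
  intro p hp q hq hpq
  refine lt_of_le_of_ne (upperTail_antitone hpq.le) fun heq => ?_
  have hconst : ∀ x ∈ Icc p q, upperTail (F i) x = upperTail (F i) p := fun x hx =>
    le_antisymm (upperTail_antitone hx.1) (heq ▸ upperTail_antitone hx.2)
  have hB : rivalTail F i p = rivalTail F i q := by
    refine Finset.prod_congr rfl fun j _ => ?_
    by_cases hj : ∀ p ∈ Ico a b, rivalTail F j p = h p
    · rw [H.eq_of_forall_tight hj hi, heq]
    · obtain ⟨c, hc, hcj, h0⟩ := H.exists_cutoff hj
      have hright : ∀ x, c ≤ x → x < b → upperTail (F j) c = upperTail (F j) x := fun x hx hxb =>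
        H.upperTail_eq_of_Ioo hx hxb.le (measure_mono_null (Ioo_subset_Ioo_right hxb.le) h0)
      have hleft := fun x => H.upperTail_eq_of_le_of_tight (p := x) hi hc hcj
      rcases le_total q c with hqc | hqc
      · rw [hleft p (hpq.le.trans hqc), hleft q hqc, heq]
      · rw [← hright q hqc hq.2]
        rcases le_total p c with hpc | hpc
        · rw [hleft p hpc, hleft c le_rfl, hconst c ⟨hpc, hqc⟩]
        · rw [← hright p hpc hp.2]
  rw [hi p hp, hi q hq] at hB
  exact (H.strictAntiOn ⟨hp.1, hp.2.le⟩ ⟨hq.1, hq.2.le⟩ hpq).ne' hB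

theorem support_of_forall_tight [Nonempty ι] (hi : ∀ p ∈ Ico a b, rivalTail F i p = h p) :
    (F i).support = Icc a b :=
  Subset.antisymm (Measure.support_subset_of_isClosed isClosed_Icc (H.mem i))
    (Icc_subset_support H.lt (H.upperTail_strictAntiOn hi))

theorem measure_right_of_cutoff {c : ℝ} (hc : c ∈ Ico a b) (h0 : F j (Ioo c b) = 0) :
    (F j).real {b} = upperTail (F j) c := by
  have h1 : F j (Ioi b) = 0 := measure_eq_zero_of_ae (H.mem j) fun x hx hm => not_lt.2 hm.2 hx
  rw [H.upperTail_eq_of_Ioo hc.2.le le_rfl h0, upperTail_eq_singleton_add, measureReal_def _ (Ioi b),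
    h1]
  simp

theorem support_of_cutoff [Nonempty ι] (hi : ∀ p ∈ Ico a b, rivalTail F i p = h p) {c : ℝ}
    (hc : c ∈ Ioo a b) (hcj : rivalTail F j c = h c) (h0 : F j (Ioo c b) = 0) :
    (F j).support = Icc a c ∪ {b} := by
  have hc' : c ∈ Ico a b := ⟨hc.1.le, hc.2⟩
  refine Subset.antisymm (Measure.support_subset_of_isClosed
    (isClosed_Icc.union isClosed_singleton) ?_) (union_subset ?_ ?_)
  · have h1 : ∀ᵐ x ∂(F j), x ∉ Ioo c b := measure_eq_zero_iff_ae_notMem.1 h0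
    filter_upwards [H.mem j, h1] with x hx hx'
    by_cases hxc : x ≤ c
    · exact Or.inl ⟨hx.1, hxc⟩
    · refine Or.inr (le_antisymm hx.2 ?_)
      by_contra! hxb
      exact hx' ⟨not_le.1 hxc, hxb⟩
  · refine Icc_subset_support hc.1 ?_
    intro p hp q hq hpq
    rw [H.upperTail_eq_of_le_of_tight hi hc' hcj hp.2.le,
      H.upperTail_eq_of_le_of_tight hi hc' hcj hq.2.le]
    exact H.upperTail_strictAntiOn hi ⟨hp.1, hp.2.trans hc.2⟩ ⟨hq.1, hq.2.trans hc.2⟩ hpq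
  · rw [singleton_subset_iff, Measure.mem_support_iff_forall]
    intro U hU
    have hpos : 0 < (F j).real {b} := by
      rw [H.measure_right_of_cutoff hc' h0]; exact H.upperTail_pos hc'
    rw [measureReal_def, ENNReal.toReal_pos_iff] at hpos
    exact hpos.1.trans_le (measure_mono (singleton_subset_iff.2 (mem_of_mem_nhds hU)))

theorem eq_dirac_of_cutoff (h0 : F j (Ioo a b) = 0) : F j = Measure.dirac b := by
  have h1 : ∀ᵐ x ∂(F j), x ∉ Ioo a b := measure_eq_zero_iff_ae_notMem.1 h0
  have h2 : ∀ᵐ x ∂(F j), x ≠ a := by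
    simpa using measure_eq_zero_iff_ae_notMem.1 (H.singleton_eq_zero (i := j) H.lt)
  have h3 : ∀ᵐ x ∂(F j), id x = b := by
    filter_upwards [H.mem j, h1, h2] with x hx hx1 hx2
    by_contra hne
    exact hx1 ⟨lt_of_le_of_ne hx.1 hx2.symm, lt_of_le_of_ne hx.2 hne⟩
  have h4 : (F j).map id = (F j).map fun _ => b := Measure.map_congr h3
  simpa using h4

theorem cdf_eq_one_sub (hp : p < b) : cdf (F i) p = 1 - upperTail (F i) p :=
  cdf_eq_one_sub_upperTail (H.singleton_eq_zero hp)

theorem continuous_cdf_of_forall_tight [Nonempty ι]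
    (hi : ∀ p ∈ Ico a b, rivalTail F i p = h p) : Continuous (cdf (F i)) := by
  have h0 := H.singleton_eq_zero_of_forall_tight hi
  have : (cdf (F i) : ℝ → ℝ) = fun p => 1 - upperTail (F i) p :=
    funext fun p => cdf_eq_one_sub_upperTail (h0 p)
  rw [this]
  exact continuous_const.sub
    (continuous_iff_continuousAt.2 fun p => StahlModel.continuousAt_upperTail (h0 p))

end TailEquilibrium

/-! ### Purchases of shoppers and searchers at given prices. -/

section Shares

variable {n : ℕ} {S : Finset (Fin n)} {x : Fin n → ℝ} {i j : Fin n} {PM : ℝ}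

theorem mem_cheapest : i ∈ cheapest S x ↔ i ∈ S ∧ ∀ j ∈ S, x i ≤ x j := by
  simp [cheapest]

theorem share_nonneg : 0 ≤ share S x i := by
  unfold share; split_ifs <;> positivity

theorem share_le_one : share S x i ≤ 1 := by
  unfold share
  split_ifs with h
  · rw [div_le_one (by exact_mod_cast Finset.card_pos.2 ⟨i, h⟩)]
    exact_mod_cast Finset.card_pos.2 ⟨i, h⟩
  · exact zero_le_one

theorem share_singleton : share {j} x i = if j = i then 1 else 0 := by
  have : cheapest {j} x = {j} := by ext k; simp +contextual [mem_cheapest]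
  simp [share, this, eq_comm]

theorem share_eq_zero (h : i ∉ cheapest S x) : share S x i = 0 := if_neg h

theorem share_eq_one (hi : i ∈ S) (h : ∀ j ∈ S, j ≠ i → x i < x j) : share S x i = 1 := by
  have : cheapest S x = {i} := by
    ext k
    rw [mem_cheapest, Finset.mem_singleton]
    refine ⟨fun hk => ?_, ?_⟩
    · by_contra hne
      exact not_le.2 (h k hk.1 hne) (hk.2 i hi)
    · rintro rfl
      refine ⟨hi, fun j hj => ?_⟩
      rcases eq_or_ne j k with rfl | hjk
      · exact le_rfl
      · exact (h j hj hjk).le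
  simp [share, this]

theorem share_le_half (hij : i ≠ j) (hj : j ∈ S) (h : x j = x i) : share S x i ≤ 1 / 2 := by
  unfold share
  split_ifs with hi
  · have hj' : j ∈ cheapest S x := mem_cheapest.2 ⟨hj, h ▸ (mem_cheapest.1 hi).2⟩
    have h2 : 2 ≤ (cheapest S x).card := Finset.one_lt_card.2 ⟨i, hi, j, hj', hij⟩
    have h2' : (2 : ℝ) ≤ (cheapest S x).card := by exact_mod_cast h2
    exact one_div_le_one_div_of_le two_pos h2'
  · norm_num

theorem mem_visited {σ : Equiv.Perm (Fin n)} :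
    i ∈ visited PM x σ ↔ ∀ j, σ.symm j < σ.symm i → PM < x j := by
  simp [visited]

theorem visited_eq_univ (h : ∀ j, PM < x j) (σ : Equiv.Perm (Fin n)) :
    visited PM x σ = Finset.univ := by
  ext k
  simp [mem_visited, h]

/-- A searcher is satisfied in the first store if it has an acceptable price. -/
theorem visited_eq_singleton [NeZero n] {σ : Equiv.Perm (Fin n)} (h : x (σ 0) ≤ PM) :
    visited PM x σ = {σ 0} := by
  ext k
  rw [mem_visited, Finset.mem_singleton]
  refine ⟨fun hk => ?_, ?_⟩
  · by_contra hne
    refine not_lt.2 h (hk (σ 0) ?_)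
    rw [Equiv.symm_apply_apply]
    exact Fin.pos_iff_ne_zero.2 fun h0 => hne (by rw [← h0, Equiv.apply_symm_apply])
  · rintro rfl j hj
    simp at hj

/-- A seller with an unacceptable price sells to a searcher only if she would sell to a shopper. -/
theorem share_visited_le (h : PM < x i) (σ : Equiv.Perm (Fin n)) :
    share (visited PM x σ) x i ≤ share Finset.univ x i := by
  by_cases hall : ∀ j, PM < x j
  · rw [visited_eq_univ hall]
  · push Not at hall
    rw [share_eq_zero]
    · exact share_nonneg
    · intro hi
      -- The first acceptable store in the order `σ` is visited and is cheaper than `i`.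
      obtain ⟨k, hk, hmin⟩ := Finset.exists_min_image (Finset.univ.filter fun j => x j ≤ PM) σ.symm
        (by obtain ⟨j, hj⟩ := hall; exact ⟨j, by simpa using hj⟩)
      have hkv : k ∈ visited PM x σ := mem_visited.2 fun j hj => by
        by_contra! hle
        exact not_lt.2 (hmin j (by simpa using hle)) hj
      have h1 := (mem_cheapest.1 hi).2 k hkv
      have h2 : x k ≤ PM := by simpa using hk
      linarith

theorem card_perm_apply_eq [NeZero n] (i : Fin n) :
    (Finset.univ.filter fun σ : Equiv.Perm (Fin n) => σ 0 = i).card * n = n ! := by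
  have hfib := Finset.card_eq_sum_card_fiberwise (f := fun σ : Equiv.Perm (Fin n) => σ 0)
    (s := Finset.univ) (t := Finset.univ) (fun _ _ => Finset.mem_coe.2 (Finset.mem_univ _))
  have hsame : ∀ j, (Finset.univ.filter fun σ : Equiv.Perm (Fin n) => σ 0 = j).card =
      (Finset.univ.filter fun σ : Equiv.Perm (Fin n) => σ 0 = i).card := fun j => by
    refine Finset.card_equiv (Equiv.mulLeft (Equiv.swap i j)) fun σ => ?_
    simp [Equiv.swap_apply_eq_iff]
  simp only [hsame, Finset.sum_const, Finset.card_univ, Fintype.card_perm, Fintype.card_fin,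
    smul_eq_mul] at hfib
  rw [hfib, mul_comm]

theorem sum_perm_apply_eq [NeZero n] (i : Fin n) :
    (∑ σ : Equiv.Perm (Fin n), if σ 0 = i then (1 : ℝ) else 0) / (n ! : ℝ) = 1 / n := by
  rw [Finset.sum_boole, ← card_perm_apply_eq i]
  have h1 : (n : ℝ) ≠ 0 := by exact_mod_cast NeZero.ne n
  have h2 : ((Finset.univ.filter fun σ : Equiv.Perm (Fin n) => σ 0 = i).card : ℝ) ≠ 0 := by
    intro h0
    have := card_perm_apply_eq i
    rw [Nat.cast_eq_zero.1 h0, zero_mul] at this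
    exact n.factorial_ne_zero this.symm
  push_cast
  field_simp

theorem measurable_share (S : Finset (Fin n)) (i : Fin n) :
    Measurable fun x : Fin n → ℝ => share S x i := by
  have hset : ∀ j, MeasurableSet {x : Fin n → ℝ | j ∈ cheapest S x} := fun j => by
    simp only [mem_cheapest]
    exact measurableSet_setOfPred.2 (Measurable.and measurable_const (Measurable.forall fun k =>
      Measurable.imp measurable_const (measurableSet_setOfPred.1
        (measurableSet_le (measurable_pi_apply _) (measurable_pi_apply _)))))
  have hcard : ∀ x : Fin n → ℝ, ((cheapest S x).card : ℝ) =
      ∑ j, if j ∈ cheapest S x then (1 : ℝ) else 0 := fun x => by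
    rw [Finset.sum_boole]; simp
  unfold share
  simp only [hcard]
  refine Measurable.ite (hset i) (measurable_const.div ?_) measurable_const
  exact Finset.measurable_sum _ fun j _ => Measurable.ite (hset j) measurable_const measurable_const

/-- Splitting according to the finitely many possible visited sets reduces this to a fixed set. -/
theorem measurable_share_visited (PM : ℝ) (σ : Equiv.Perm (Fin n)) (i : Fin n) :
    Measurable fun x : Fin n → ℝ => share (visited PM x σ) x i := by
  have hsum : (fun x : Fin n → ℝ => share (visited PM x σ) x i) =
      fun x => ∑ S, if visited PM x σ = S then share S x i else 0 := by
    ext x; simp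
  rw [hsum]
  refine Finset.measurable_sum _ fun S _ =>
    Measurable.ite ?_ (measurable_share S i) measurable_const
  simp only [Finset.ext_iff, mem_visited]
  refine measurableSet_setOfPred.2 (Measurable.forall fun k => Measurable.iff (Measurable.forall
    fun j => Measurable.imp measurable_const ?_) measurable_const)
  exact measurableSet_setOfPred.1 (measurableSet_lt measurable_const (measurable_pi_apply _))

end Shares

/-! ### Bounds on the quantity sold by one seller. -/

section Quantities

variable (m : StahlModel) {PM : ℝ} {x : Fin m.n → ℝ} {i j : Fin m.n}

instance : NeZero m.n := ⟨by have := m.two_le_n; omega⟩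

instance : Nontrivial (Fin m.n) := Fin.nontrivial_iff_two_le.2 m.two_le_n

theorem searchers_pos : 0 < (1 - m.μ) / m.n := by
  have := m.μ_lt_one
  have h : (0 : ℝ) < m.n := by exact_mod_cast (NeZero.pos m.n)
  exact div_pos (by linarith) h

theorem measurable_quantity (PM : ℝ) (i : Fin m.n) : Measurable fun x => m.quantity PM x i := by
  unfold quantity
  exact ((measurable_share _ i).const_mul _).add (((Finset.measurable_sum _ fun σ _ =>
    measurable_share_visited PM σ i).div_const _).const_mul _)

theorem quantity_nonneg : 0 ≤ m.quantity PM x i := by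
  have := m.μ_lt_one
  exact add_nonneg (mul_nonneg m.μ_pos.le share_nonneg) (mul_nonneg (by linarith)
    (div_nonneg (Finset.sum_nonneg fun _ _ => share_nonneg) (Nat.cast_nonneg _)))

theorem average_le {n : ℕ} {f : Equiv.Perm (Fin n) → ℝ} {c : ℝ} (h : ∀ σ, f σ ≤ c) :
    (∑ σ, f σ) / (n ! : ℝ) ≤ c := by
  rw [div_le_iff₀ (by exact_mod_cast n.factorial_pos)]
  refine (Finset.sum_le_sum fun σ _ => h σ).trans_eq ?_
  simp [Fintype.card_perm, mul_comm]

theorem quantity_le_one : m.quantity PM x i ≤ 1 := by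
  have := m.μ_lt_one
  have := m.μ_pos
  have h1 : share Finset.univ x i ≤ 1 := share_le_one
  have h2 : (∑ σ : Equiv.Perm (Fin m.n), share (visited PM x σ) x i) / (m.n ! : ℝ) ≤ 1 :=
    average_le fun _ => share_le_one
  unfold quantity
  nlinarith

theorem quantity_le_share (h : PM < x i) : m.quantity PM x i ≤ share Finset.univ x i := by
  have := m.μ_lt_one
  have h2 : (∑ σ : Equiv.Perm (Fin m.n), share (visited PM x σ) x i) / (m.n ! : ℝ) ≤
      share Finset.univ x i := average_le fun σ => share_visited_le h σ
  unfold quantity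
  nlinarith

theorem quantity_eq_one (h : PM < x i) (hi : ∀ j, j ≠ i → x i < x j) : m.quantity PM x i = 1 := by
  have h1 : share Finset.univ x i = 1 := share_eq_one (Finset.mem_univ i) fun j _ => hi j
  have hall : ∀ j, PM < x j := fun j => by
    rcases eq_or_ne j i with rfl | hj
    · exact h
    · exact h.trans (hi j hj)
  unfold quantity
  simp only [visited_eq_univ hall, h1, Finset.sum_const, Finset.card_univ, Fintype.card_perm,
    Fintype.card_fin, nsmul_eq_mul, mul_one]
  rw [div_self (by exact_mod_cast m.n.factorial_ne_zero)]
  ring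

theorem le_quantity (h : x i ≤ PM) :
    (1 - m.μ) / m.n + m.μ * share Finset.univ x i ≤ m.quantity PM x i := by
  have hlt := m.μ_lt_one
  have hsum : 1 / (m.n : ℝ) ≤
      (∑ σ : Equiv.Perm (Fin m.n), share (visited PM x σ) x i) / (m.n ! : ℝ) := by
    rw [← sum_perm_apply_eq i]
    refine div_le_div_of_nonneg_right (Finset.sum_le_sum fun σ _ => ?_) (Nat.cast_nonneg _)
    split_ifs with hσ
    · rw [visited_eq_singleton (hσ.symm ▸ h), share_singleton, if_pos hσ]
    · exact share_nonneg
  unfold quantity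
  have := mul_le_mul_of_nonneg_left hsum (show 0 ≤ 1 - m.μ by linarith)
  rw [mul_one_div] at this
  linarith

theorem quantity_eq (h : ∀ j, x j ≤ PM) :
    m.quantity PM x i = (1 - m.μ) / m.n + m.μ * share Finset.univ x i := by
  unfold quantity
  simp only [visited_eq_singleton (h _), share_singleton, sum_perm_apply_eq]
  ring

/-- The price profiles in which all prices except that of `i` are at least `p`. -/
def rivalsAbove (i : Fin m.n) (p : ℝ) : Set (Fin m.n → ℝ) :=
  univ.pi (Function.update (fun _ => Ici p) i univ)

/-- The price profiles in which all prices except that of `i` are at least `p`, and that of `j` is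
equal to `p`. -/
def rivalsTied (i j : Fin m.n) (p : ℝ) : Set (Fin m.n → ℝ) :=
  univ.pi (Function.update (Function.update (fun _ => Ici p) i univ) j {p})

variable {p q : ℝ}

theorem mem_rivalsAbove : x ∈ m.rivalsAbove i p ↔ ∀ j, j ≠ i → p ≤ x j := by
  simp only [rivalsAbove, mem_univ_pi]
  refine forall_congr' fun k => ?_
  by_cases hk : k = i
  · subst hk; simp
  · simp [hk]

theorem mem_rivalsTied (hij : i ≠ j) :
    x ∈ m.rivalsTied i j p ↔ x ∈ m.rivalsAbove i p ∧ x j = p := by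
  rw [mem_rivalsAbove]
  simp only [rivalsTied, mem_univ_pi]
  constructor
  · intro h
    have hj : x j = p := by simpa using h j
    refine ⟨fun k hk => ?_, hj⟩
    rcases eq_or_ne k j with rfl | hkj
    · exact hj.ge
    · simpa [hk, hkj] using h k
  · rintro ⟨h, hj⟩ k
    rcases eq_or_ne k j with rfl | hkj
    · simpa using hj
    · rcases eq_or_ne k i with rfl | hk
      · simp [hkj]
      · simpa [hk, hkj] using h k hk

theorem measurableSet_rivalsAbove : MeasurableSet (m.rivalsAbove i p) := by
  refine MeasurableSet.univ_pi fun k => ?_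
  by_cases hk : k = i
  · subst hk; simp
  · simp [hk]

theorem measurableSet_rivalsTied : MeasurableSet (m.rivalsTied i j p) := by
  refine MeasurableSet.univ_pi fun k => ?_
  by_cases hkj : k = j
  · subst hkj; simp
  by_cases hk : k = i
  · subst hk; simp [hkj]
  · simp [hk, hkj]

/-- The correction for a draw with one rival `j` is what makes a mass point shared with `j` strictly
worse than undercutting it. -/
theorem share_update_le (hij : i ≠ j) :
    share Finset.univ (Function.update x i p) i ≤
      (m.rivalsAbove i p).indicator 1 x - 1 / 2 * (m.rivalsTied i j p).indicator 1 x := by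
  by_cases hx : x ∈ m.rivalsAbove i p
  · by_cases hj : x j = p
    · rw [indicator_of_mem hx, indicator_of_mem ((m.mem_rivalsTied hij).2 ⟨hx, hj⟩)]
      refine (share_le_half hij (Finset.mem_univ j) ?_).trans (by norm_num)
      simp [hij.symm, hj]
    · rw [indicator_of_mem hx,
        indicator_of_notMem fun h => hj ((m.mem_rivalsTied hij).1 h).2]
      simpa using share_le_one
  · rw [indicator_of_notMem hx, indicator_of_notMem fun h => hx ((m.mem_rivalsTied hij).1 h).1,
      share_eq_zero]
    · simp
    · intro hi
      refine hx (m.mem_rivalsAbove.2 fun k hk => ?_)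
      simpa [hk] using (mem_cheapest.1 hi).2 k (Finset.mem_univ k)

/-- The gap between `p` and `q` excludes draws; it is removed later by letting the lower price tend
to the higher one. -/
theorem le_share_update (hpq : p < q) :
    (m.rivalsAbove i q).indicator 1 x ≤ share Finset.univ (Function.update x i p) i := by
  by_cases hx : x ∈ m.rivalsAbove i q
  · rw [indicator_of_mem hx, share_eq_one (Finset.mem_univ i)]
    · rfl
    · intro k _ hk
      simpa [hk] using hpq.trans_le (m.mem_rivalsAbove.1 hx k hk)
  · rw [indicator_of_notMem hx]
    exact share_nonneg

end Quantities

/-! ### Expected demand, and optimality price by price. -/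

section Demand

variable (m : StahlModel) {PM : ℝ} (F : Fin m.n → ProbabilityMeasure ℝ) (i : Fin m.n) {p q : ℝ}

/-- The joint law of the prices. -/
noncomputable def priceLaw : Measure (Fin m.n → ℝ) := Measure.pi fun j => (F j : Measure ℝ)

instance : IsProbabilityMeasure (m.priceLaw F) := by unfold priceLaw; infer_instance

/-- The expected quantity that seller `i` sells at the price `p`. -/
noncomputable def demand (PM : ℝ) (p : ℝ) : ℝ :=
  ∫ x, m.quantity PM (Function.update x i p) i ∂(m.priceLaw F)

theorem measurable_update_pair {n : ℕ} (i : Fin n) :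
    Measurable fun z : ℝ × (Fin n → ℝ) => Function.update z.2 i z.1 :=
  measurable_pi_iff.2 fun k => by
    by_cases hk : k = i
    · subst hk; simpa using measurable_fst
    · simpa [hk] using measurable_snd.eval

/-- Independence lets the price of `i` be redrawn from `s`, so that by Fubini the profit is an
integral over the own price. -/
theorem map_update_priceLaw (s : ProbabilityMeasure ℝ) :
    ((s : Measure ℝ).prod (m.priceLaw F)).map (fun z => Function.update z.2 i z.1) =
      m.priceLaw (Function.update F i s) := by
  symm
  refine Measure.pi_eq fun t ht => ?_
  have hpre : (fun z : ℝ × (Fin m.n → ℝ) => Function.update z.2 i z.1) ⁻¹' univ.pi t =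
      t i ×ˢ univ.pi (Function.update t i univ) := by
    ext z
    simp only [mem_preimage, mem_univ_pi, mem_prod]
    constructor
    · refine fun h => ⟨by simpa using h i, fun k => ?_⟩
      by_cases hk : k = i
      · subst hk; simp
      · simpa [hk] using h k
    · rintro ⟨h1, h2⟩ k
      by_cases hk : k = i
      · subst hk; simpa using h1
      · simpa [hk] using h2 k
  rw [Measure.map_apply (measurable_update_pair i) (MeasurableSet.univ_pi ht), hpre, Measure.prod_prod, priceLaw,
    Measure.pi_pi, ← Finset.mul_prod_erase _ _ (Finset.mem_univ i),
    ← Finset.mul_prod_erase Finset.univ (fun k => (Function.update F i s k : Measure ℝ) (t k))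
      (Finset.mem_univ i)]
  simp only [Function.update_self, measure_univ, one_mul]
  congr 1
  refine Finset.prod_congr rfl fun k hk => ?_
  simp [Finset.ne_of_mem_erase hk]

theorem measurable_quantity_update (PM : ℝ) :
    Measurable fun z : ℝ × (Fin m.n → ℝ) => m.quantity PM (Function.update z.2 i z.1) i :=
  (m.measurable_quantity PM i).comp (measurable_update_pair i)

theorem integrable_quantity_update (PM p : ℝ) :
    Integrable (fun x => m.quantity PM (Function.update x i p) i) (m.priceLaw F) := by
  refine Integrable.of_bound ((m.measurable_quantity_update i PM).comp
    (measurable_const.prodMk measurable_id)).aestronglyMeasurable 1 (ae_of_all _ fun x => ?_)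
  simpa [abs_of_nonneg (m.quantity_nonneg)] using m.quantity_le_one

theorem integrable_price_mul_quantity {s : ProbabilityMeasure ℝ} (hs : m.IsStrategy s) :
    Integrable (fun z : ℝ × (Fin m.n → ℝ) => z.1 * m.quantity PM (Function.update z.2 i z.1) i)
      ((s : Measure ℝ).prod (m.priceLaw F)) := by
  refine Integrable.of_bound
    (measurable_fst.mul (m.measurable_quantity_update i PM)).aestronglyMeasurable m.M ?_
  filter_upwards [Measure.quasiMeasurePreserving_fst.ae hs] with z hz
  rw [Real.norm_eq_abs, abs_of_nonneg (mul_nonneg hz.1 m.quantity_nonneg)]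
  exact (mul_le_of_le_one_right hz.1 m.quantity_le_one).trans hz.2

theorem profit_update {s : ProbabilityMeasure ℝ} (hs : m.IsStrategy s) :
    m.profit PM (Function.update F i s) i = ∫ p, p * m.demand F i PM p ∂(s : Measure ℝ) := by
  have h := m.map_update_priceLaw F i s
  rw [profit, ← priceLaw, ← h, integral_map]
  · simp only [Function.update_self]
    rw [integral_prod _ (m.integrable_price_mul_quantity F i hs)]
    simp only [demand, integral_const_mul]
  · exact (measurable_update_pair i).aemeasurable
  · exact ((measurable_pi_apply i).mul (m.measurable_quantity PM i)).aestronglyMeasurable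

theorem integrable_price_mul_demand {s : ProbabilityMeasure ℝ} (hs : m.IsStrategy s) :
    Integrable (fun p => p * m.demand F i PM p) (s : Measure ℝ) := by
  have h := (m.integrable_price_mul_quantity (PM := PM) F i hs).integral_prod_left
  simpa only [demand, integral_const_mul] using h

variable {F}

/-- In equilibrium no price yields more than the equilibrium profit. -/
theorem IsNash.price_mul_demand_le (hF : m.IsNash PM F) (hp : p ∈ Icc 0 m.M) :
    p * m.demand F i PM p ≤ m.profit PM F i := by
  let s : ProbabilityMeasure ℝ := ⟨Measure.dirac p, inferInstance⟩
  have hs : m.IsStrategy s := (ae_dirac_iff measurableSet_Icc).2 hp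
  have h := hF.seller_optimal i s hs
  rw [m.profit_update F i hs] at h
  simpa [s] using h

/-- In equilibrium almost all prices of a seller yield the equilibrium profit. -/
theorem IsNash.ae_price_mul_demand_eq (hF : m.IsNash PM F) :
    ∀ᵐ p ∂(F i : Measure ℝ), p ∈ Icc 0 m.M ∧ p * m.demand F i PM p = m.profit PM F i := by
  have hs := hF.isStrategy i
  have hint := m.integrable_price_mul_demand (PM := PM) F i hs
  have h := m.profit_update (PM := PM) F i hs
  rw [Function.update_eq_self] at h
  have h0 : ∫ p, (m.profit PM F i - p * m.demand F i PM p) ∂(F i : Measure ℝ) = 0 := by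
    rw [integral_sub (integrable_const _) hint, ← h]; simp
  rw [integral_eq_zero_iff_of_nonneg_ae ?_
    (show Integrable (fun p => m.profit PM F i - p * m.demand F i PM p) _ from
      (integrable_const _).sub hint)] at h0
  · filter_upwards [h0, hs] with p hp hps
    exact ⟨hps, (sub_eq_zero.1 hp).symm⟩
  · filter_upwards [hs] with p hp
    exact sub_nonneg.2 (hF.price_mul_demand_le m i hp)

variable (F)

/-- The probability that all prices except that of `i` are at least `p`, and that of `j` is equal
to `p`. -/
noncomputable def tieProb {n : ℕ} (F : Fin n → Measure ℝ) (i j : Fin n) (p : ℝ) : ℝ :=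
  (F j).real {p} * ∏ k ∈ (Finset.univ.erase i).erase j, upperTail (F k) p

theorem priceLaw_rivalsAbove :
    (m.priceLaw F).real (m.rivalsAbove i p) = rivalTail (fun j => (F j : Measure ℝ)) i p := by
  rw [measureReal_def, priceLaw, rivalsAbove, Measure.pi_pi, ENNReal.toReal_prod,
    ← Finset.mul_prod_erase _ _ (Finset.mem_univ i), rivalTail]
  simp only [Function.update_self, measure_univ, ENNReal.toReal_one, one_mul]
  refine Finset.prod_congr rfl fun k hk => ?_
  rw [Function.update_of_ne (Finset.ne_of_mem_erase hk)]
  rfl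

theorem priceLaw_rivalsTied {j : Fin m.n} (hij : i ≠ j) :
    (m.priceLaw F).real (m.rivalsTied i j p) = tieProb (fun j => (F j : Measure ℝ)) i j p := by
  rw [measureReal_def, priceLaw, rivalsTied, Measure.pi_pi, ENNReal.toReal_prod,
    ← Finset.mul_prod_erase _ _ (Finset.mem_univ i),
    ← Finset.mul_prod_erase _ _ (Finset.mem_erase.2 ⟨hij.symm, Finset.mem_univ j⟩), tieProb]
  simp only [Function.update_self, Function.update_of_ne hij, measure_univ, ENNReal.toReal_one,
    one_mul]
  refine congrArg₂ _ rfl (Finset.prod_congr rfl fun k hk => ?_)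
  rw [Function.update_of_ne (Finset.ne_of_mem_erase hk),
    Function.update_of_ne (Finset.ne_of_mem_erase (Finset.mem_of_mem_erase hk))]
  rfl

theorem le_demand_of_forall {α β : ℝ} (h : ∀ x : Fin m.n → ℝ,
      α + β * (m.rivalsAbove i q).indicator 1 x ≤ m.quantity PM (Function.update x i p) i) :
    α + β * rivalTail (fun j => (F j : Measure ℝ)) i q ≤ m.demand F i PM p := by
  have hi : Integrable ((m.rivalsAbove i q).indicator (1 : (Fin m.n → ℝ) → ℝ)) (m.priceLaw F) :=
    (integrable_const 1).indicator m.measurableSet_rivalsAbove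
  have := integral_mono ((integrable_const α).add (hi.const_mul β))
    (m.integrable_quantity_update F i PM p) h
  simp only [Pi.add_apply] at this
  rw [integral_add (integrable_const α) (hi.const_mul β), integral_const_mul,
    integral_indicator_one m.measurableSet_rivalsAbove, priceLaw_rivalsAbove] at this
  simpa [demand] using this

theorem demand_le_of_ae {α β : ℝ} {j : Fin m.n} (hij : i ≠ j)
    (h : ∀ᵐ x ∂(m.priceLaw F), m.quantity PM (Function.update x i p) i ≤
      α + β * ((m.rivalsAbove i p).indicator 1 x - 1 / 2 * (m.rivalsTied i j p).indicator 1 x)) :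
    m.demand F i PM p ≤ α + β * (rivalTail (fun j => (F j : Measure ℝ)) i p -
      1 / 2 * tieProb (fun j => (F j : Measure ℝ)) i j p) := by
  have h1 : Integrable ((m.rivalsAbove i p).indicator (1 : (Fin m.n → ℝ) → ℝ)) (m.priceLaw F) :=
    (integrable_const 1).indicator m.measurableSet_rivalsAbove
  have h2 : Integrable ((m.rivalsTied i j p).indicator (1 : (Fin m.n → ℝ) → ℝ)) (m.priceLaw F) :=
    (integrable_const 1).indicator m.measurableSet_rivalsTied
  have h3 : Integrable (fun x => (m.rivalsAbove i p).indicator (1 : (Fin m.n → ℝ) → ℝ) x -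
      1 / 2 * (m.rivalsTied i j p).indicator 1 x) (m.priceLaw F) := h1.sub (h2.const_mul (1 / 2))
  have := integral_mono_ae (m.integrable_quantity_update F i PM p)
    ((integrable_const α).add (h3.const_mul β)) h
  simp only [Pi.add_apply] at this
  rw [integral_add (integrable_const α) (h3.const_mul β), integral_const_mul,
    integral_sub h1 (h2.const_mul (1 / 2)), integral_const_mul,
    integral_indicator_one m.measurableSet_rivalsAbove, priceLaw_rivalsAbove,
    integral_indicator_one m.measurableSet_rivalsTied, priceLaw_rivalsTied _ _ _ hij] at this
  simpa [demand] using this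

theorem le_demand (hp : p ≤ PM) (hpq : p < q) :
    (1 - m.μ) / m.n + m.μ * rivalTail (fun j => (F j : Measure ℝ)) i q ≤ m.demand F i PM p := by
  refine m.le_demand_of_forall F i fun x => ?_
  refine le_trans ?_ (m.le_quantity (by simpa using hp))
  gcongr
  · exact m.μ_pos.le
  · exact m.le_share_update hpq

theorem rivalTail_le_demand (hp : PM < p) (hpq : p < q) :
    rivalTail (fun j => (F j : Measure ℝ)) i q ≤ m.demand F i PM p := by
  have := m.le_demand_of_forall (PM := PM) (p := p) (q := q) (α := 0) (β := 1) F i fun x => ?_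
  · simpa using this
  · rw [zero_add, one_mul]
    by_cases hx : x ∈ m.rivalsAbove i q
    · rw [indicator_of_mem hx, m.quantity_eq_one (by simpa using hp)]
      · rfl
      · intro k hk
        simpa [hk] using hpq.trans_le (m.mem_rivalsAbove.1 hx k hk)
    · rw [indicator_of_notMem hx]
      exact m.quantity_nonneg

theorem demand_le_of_gt {j : Fin m.n} (hij : i ≠ j) (hp : PM < p) :
    m.demand F i PM p ≤ rivalTail (fun j => (F j : Measure ℝ)) i p -
      1 / 2 * tieProb (fun j => (F j : Measure ℝ)) i j p := by
  have := m.demand_le_of_ae (PM := PM) (p := p) (α := 0) (β := 1) F i hij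
    (ae_of_all _ fun x => ?_)
  · simpa using this
  · rw [zero_add, one_mul]
    exact (m.quantity_le_share (by simpa using hp)).trans (m.share_update_le hij)

theorem demand_le {j : Fin m.n} (hij : i ≠ j) (hle : ∀ j, ∀ᵐ p ∂(F j : Measure ℝ), p ≤ PM)
    (hp : p ≤ PM) :
    m.demand F i PM p ≤ (1 - m.μ) / m.n + m.μ * (rivalTail (fun j => (F j : Measure ℝ)) i p -
      1 / 2 * tieProb (fun j => (F j : Measure ℝ)) i j p) := by
  refine m.demand_le_of_ae F i hij ?_
  have hall : ∀ᵐ x ∂(m.priceLaw F), ∀ j, x j ≤ PM :=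
    ae_all_iff.2 fun j => (Measure.tendsto_eval_ae_ae
      (μ := fun j => (F j : Measure ℝ)) (i := j)).eventually (hle j)
  filter_upwards [hall] with x hx
  rw [m.quantity_eq fun k => ?_]
  · gcongr
    · exact m.μ_pos.le
    · exact m.share_update_le hij
  · by_cases hk : k = i
    · subst hk; simpa using hp
    · simpa [hk] using hx k

end Demand

theorem tieProb_pos {n : ℕ} {F : Fin n → Measure ℝ} [∀ i, IsProbabilityMeasure (F i)]
    {i j : Fin n} {p : ℝ} (hj : F j {p} ≠ 0)
    (h : ∀ k, k ≠ i → k ≠ j → 0 < upperTail (F k) p) : 0 < tieProb F i j p :=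
  mul_pos (ENNReal.toReal_pos hj (measure_ne_top _ _)) (Finset.prod_pos fun k hk =>
    h k (Finset.ne_of_mem_erase (Finset.mem_of_mem_erase hk)) (Finset.ne_of_mem_erase hk))

theorem tieProb_nonneg {n : ℕ} {F : Fin n → Measure ℝ} {i j : Fin n} {p : ℝ} :
    0 ≤ tieProb F i j p :=
  mul_nonneg measureReal_nonneg (Finset.prod_nonneg fun _ _ => upperTail_nonneg)

theorem upperTail_pos_of_singleton {ν : Measure ℝ} [IsProbabilityMeasure ν] {p : ℝ}
    (h : ν {p} ≠ 0) : 0 < upperTail ν p :=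
  (ENNReal.toReal_pos h (measure_ne_top _ _)).trans_le (measureReal_mono (by simp))

theorem mul_le_of_forall_lt {r p C D : ℝ} (hr : r < p) (h : ∀ q, r < q → q < p → q * C ≤ D) :
    p * C ≤ D := by
  have hlim : Tendsto (fun q : ℝ => q * C) (𝓝[<] p) (𝓝 (p * C)) :=
    ((continuous_id.mul continuous_const).tendsto p).mono_left nhdsWithin_le_nhds
  refine le_of_tendsto hlim ?_
  filter_upwards [Ioo_mem_nhdsLT hr] with q hq using h q hq.1 hq.2

/-! ### Equilibrium profits and the reduction to the tail conditions. -/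

namespace IsNash

variable {m : StahlModel} {PM : ℝ} {F : Fin m.n → ProbabilityMeasure ℝ} (hF : m.IsNash PM F)
  {i j : Fin m.n} {p : ℝ}

include hF

theorem reserve_pos : 0 < PM := by
  have h : m.c / 2 < m.c := half_lt_self m.c_pos
  exact (half_pos m.c_pos).trans_le (hF.accept_below_cost _ h)

/-- A seller can undercut all rivals whose prices are at least `p`. -/
theorem price_mul_le_profit (i : Fin m.n) (hp : p ∈ Ioc 0 PM) :
    p * ((1 - m.μ) / m.n + m.μ * rivalTail (fun j => (F j : Measure ℝ)) i p) ≤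
      m.profit PM F i :=
  mul_le_of_forall_lt hp.1 fun _ h0 hq =>
    (mul_le_mul_of_nonneg_left (m.le_demand F i (hq.le.trans hp.2) hq) h0.le).trans
      (hF.price_mul_demand_le m i ⟨h0.le, (hq.le.trans hp.2).trans hF.reserve_le⟩)

theorem price_mul_le_profit_of_gt (i : Fin m.n) (hp : p ∈ Ioc PM m.M) :
    p * rivalTail (fun j => (F j : Measure ℝ)) i p ≤ m.profit PM F i :=
  mul_le_of_forall_lt hp.1 fun _ h0 hq =>
    (mul_le_mul_of_nonneg_left (m.rivalTail_le_demand F i h0 hq)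
      (hF.reserve_pos.le.trans h0.le)).trans
      (hF.price_mul_demand_le m i ⟨hF.reserve_pos.le.trans h0.le, hq.le.trans hp.2⟩)

theorem reserve_mul_le_profit (i : Fin m.n) : PM * ((1 - m.μ) / m.n) ≤ m.profit PM F i := by
  refine le_trans ?_ (hF.price_mul_le_profit i ⟨hF.reserve_pos, le_rfl⟩)
  refine mul_le_mul_of_nonneg_left ?_ hF.reserve_pos.le
  exact le_add_of_nonneg_right (mul_nonneg m.μ_pos.le rivalTail_nonneg)

theorem profit_pos (i : Fin m.n) : 0 < m.profit PM F i :=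
  (mul_pos hF.reserve_pos m.searchers_pos).trans_le (hF.reserve_mul_le_profit i)

/-- Nobody chooses a price above the reserve price. -/
theorem ae_le_reserve (i : Fin m.n) : ∀ᵐ p ∂(F i : Measure ℝ), p ≤ PM := by
  have hM : 0 < m.M := hF.reserve_pos.trans_le hF.reserve_le
  have h0 : (F i : Measure ℝ) (Ioi PM) = 0 := by
    refine measure_Ioi_eq_zero_of_rivalTail_ge (F := fun j => (F j : Measure ℝ))
      -- A price `p ∈ (PM, M]` earns at most `M * B_i p`, which has to match the profit `PM (1 - μ)
      -- / n` available at `PM`.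
      (δ := PM * ((1 - m.μ) / m.n) / m.M)
      (div_pos (mul_pos hF.reserve_pos m.searchers_pos) hM) (fun i => ?_) (fun p hp => ?_) i
    · filter_upwards [hF.ae_price_mul_demand_eq m i] with p hp hPM
      obtain ⟨j, hj⟩ := exists_ne i
      rw [div_le_iff₀ hM]
      have h1 := m.demand_le_of_gt F i hj.symm hPM
      have h2 := tieProb_nonneg (F := fun j => (F j : Measure ℝ)) (i := i) (j := j) (p := p)
      have h3 := hF.reserve_mul_le_profit i
      have h4 : p * m.demand F i PM p ≤ p * rivalTail (fun j => (F j : Measure ℝ)) i p :=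
        mul_le_mul_of_nonneg_left (by linarith) hp.1.1
      have h5 : p * rivalTail (fun j => (F j : Measure ℝ)) i p ≤
          m.M * rivalTail (fun j => (F j : Measure ℝ)) i p :=
        mul_le_mul_of_nonneg_right hp.1.2 rivalTail_nonneg
      linarith [hp.2]
    · by_contra! hatom
      obtain ⟨j, hj⟩ := exists_ne i
      have hp1 := of_ae_of_singleton (hF.ae_price_mul_demand_eq m i) (hatom i)
      have h1 := m.demand_le_of_gt F i hj.symm hp
      have h2 : 0 < tieProb (fun j => (F j : Measure ℝ)) i j p :=
        tieProb_pos (hatom j) fun k _ _ => upperTail_pos_of_singleton (hatom k)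
      have h3 := hF.price_mul_le_profit_of_gt i ⟨hp, hp1.1.2⟩
      have h4 := mul_le_mul_of_nonneg_left h1 hp1.1.1
      have h5 := mul_pos (hF.reserve_pos.trans hp) h2
      linarith [hp1.2]
  filter_upwards [measure_eq_zero_iff_ae_notMem.1 h0] with p hp using not_lt.1 hp

/-- Almost all prices of a seller are optimal, even if she did not have to share with rivals who
choose the same price. -/
theorem ae_price_mul_eq (i : Fin m.n) : ∀ᵐ p ∂(F i : Measure ℝ), p ∈ Ioc 0 PM ∧
    p * ((1 - m.μ) / m.n + m.μ * rivalTail (fun j => (F j : Measure ℝ)) i p) =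
      m.profit PM F i := by
  filter_upwards [hF.ae_price_mul_demand_eq m i, hF.ae_le_reserve i] with p hp hPM
  obtain ⟨j, hj⟩ := exists_ne i
  have hpos : 0 < p := by
    refine lt_of_le_of_ne hp.1.1 fun h => ?_
    have := hF.profit_pos i
    rw [← hp.2, ← h] at this
    simp at this
  refine ⟨⟨hpos, hPM⟩, le_antisymm (hF.price_mul_le_profit i ⟨hpos, hPM⟩) ?_⟩
  rw [← hp.2]
  refine mul_le_mul_of_nonneg_left ((m.demand_le F i hj.symm hF.ae_le_reserve hPM).trans ?_) hpos.le
  have h2 := mul_nonneg m.μ_pos.le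
    (tieProb_nonneg (F := fun j => (F j : Measure ℝ)) (i := i) (j := j) (p := p))
  linarith

/-- If `B_i p > 0`, a draw at `p` as the lowest price has positive probability, and undercutting
would be a strict gain. -/
theorem rivalTail_eq_zero_of_tie (hij : i ≠ j) (hi : (F i : Measure ℝ) {p} ≠ 0)
    (hj : (F j : Measure ℝ) {p} ≠ 0) : rivalTail (fun j => (F j : Measure ℝ)) i p = 0 := by
  by_contra h0
  have hp := of_ae_of_singleton (hF.ae_price_mul_eq i) hi
  have hp' := of_ae_of_singleton (hF.ae_price_mul_demand_eq m i) hi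
  have h1 := mul_le_mul_of_nonneg_left (m.demand_le F i hij hF.ae_le_reserve hp.1.2) hp.1.1.le
  have h2 : 0 < tieProb (fun j => (F j : Measure ℝ)) i j p :=
    tieProb_pos hj fun k hk _ => upperTail_nonneg.lt_of_ne'
      (Finset.prod_ne_zero_iff.1 h0 k (Finset.mem_erase.2 ⟨hk, Finset.mem_univ k⟩))
  have h3 := mul_pos hp.1.1 (mul_pos m.μ_pos h2)
  linarith [hp.2, hp'.2]

/-- Seller `i` imitates an optimal price of `j` that `j` hardly ever undercuts. The rivals other
than `i` and `j` are common to both, so `i` loses at most a multiple of `1 - S_j p` relative to `j`.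
-/
theorem profit_le_profit (i j : Fin m.n) : m.profit PM F j ≤ m.profit PM F i := by
  rcases eq_or_ne i j with rfl | hij
  · exact le_rfl
  refine le_of_forall_pos_lt_add fun ε hε => ?_
  have hC : 0 < PM * m.μ := mul_pos hF.reserve_pos m.μ_pos
  obtain ⟨p, ⟨hp, hpj⟩, hS⟩ := exists_upperTail_gt (hF.ae_price_mul_eq j) (div_pos hε hC)
  have hpi := hF.price_mul_le_profit i hp
  rw [rivalTail, ← Finset.mul_prod_erase _ _ (Finset.mem_erase.2 ⟨hij, Finset.mem_univ i⟩)] at hpj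
  rw [rivalTail, ← Finset.mul_prod_erase _ _ (Finset.mem_erase.2 ⟨hij.symm, Finset.mem_univ j⟩),
    Finset.erase_right_comm] at hpi
  set R := ∏ k ∈ (Finset.univ.erase j).erase i, upperTail (F k : Measure ℝ) p
  have hR0 : 0 ≤ R := Finset.prod_nonneg fun _ _ => upperTail_nonneg
  have hR1 : R ≤ 1 := Finset.prod_le_one (fun _ _ => upperTail_nonneg) fun _ _ => upperTail_le_one
  have hi1 : upperTail (F i : Measure ℝ) p ≤ 1 := upperTail_le_one
  have hj1 : upperTail (F j : Measure ℝ) p ≤ 1 := upperTail_le_one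
  set u := upperTail (F i : Measure ℝ) p
  set v := upperTail (F j : Measure ℝ) p
  have h1 : (1 - v) * (PM * m.μ) < ε := by
    rw [← lt_div_iff₀ hC]; linarith
  have h2 : u * R - v * R ≤ 1 - v := by nlinarith
  have h3 : p * m.μ * (u * R - v * R) ≤ p * m.μ * (1 - v) :=
    mul_le_mul_of_nonneg_left h2 (mul_nonneg hp.1.le m.μ_pos.le)
  have h4 : p * m.μ * (1 - v) ≤ PM * m.μ * (1 - v) :=
    mul_le_mul_of_nonneg_right (mul_le_mul_of_nonneg_right hp.2 m.μ_pos.le) (by linarith)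
  linarith

theorem profit_eq (i : Fin m.n) : m.profit PM F i = PM * ((1 - m.μ) / m.n) := by
  refine le_antisymm ?_ (hF.reserve_mul_le_profit i)
  by_contra! hlt
  set d := m.profit PM F i - PM * ((1 - m.μ) / m.n) with hd
  have hC : 0 < PM * m.μ := mul_pos hF.reserve_pos m.μ_pos
  -- If profits exceeded `PM (1 - μ) / n` by `d`, shoppers would have to contribute at least `d` at
  -- every price used, so `B_j ≥ d / (PM μ)` there. Any negative threshold would do in place of
  -- `-1`: all the mass lies above it.
  have h0 : (F i : Measure ℝ) (Ioi (-1)) = 0 := by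
    refine measure_Ioi_eq_zero_of_rivalTail_ge (F := fun j => (F j : Measure ℝ))
      (δ := d / (PM * m.μ)) (div_pos (by linarith) hC) (fun j => ?_) (fun p _ => ?_) i
    · filter_upwards [hF.ae_price_mul_eq j] with p ⟨hp, hpj⟩ _
      rw [div_le_iff₀ hC]
      have h1 := hF.profit_le_profit j i
      have h2 := mul_le_mul_of_nonneg_right hp.2 (add_nonneg m.searchers_pos.le
        (mul_nonneg m.μ_pos.le (rivalTail_nonneg (F := fun j => (F j : Measure ℝ)) (i := j)
          (p := p))))
      linarith
    · by_contra! hatom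
      obtain ⟨j, hj⟩ := exists_ne i
      exact Finset.prod_ne_zero_iff.2 (fun k _ => (upperTail_pos_of_singleton (hatom k)).ne')
        (hF.rivalTail_eq_zero_of_tie hj.symm (hatom i) (hatom j))
  have h1 : (F i : Measure ℝ) (Iic (-1)) = 0 := measure_eq_zero_of_ae (hF.isStrategy i)
    fun p hp hm => by linarith [hm.1, mem_Iic.1 hp]
  have h2 : (F i : Measure ℝ) univ = 0 := by
    rw [← Iic_union_Ioi (a := (-1 : ℝ))]
    exact measure_union_null h1 h0
  simp at h2

/-- The sellers' equilibrium conditions in terms of the upper tails of their strategies. -/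
theorem tailEquilibrium : TailEquilibrium (fun j => (F j : Measure ℝ))
    (fun p => (PM * ((1 - m.μ) / m.n) / p - (1 - m.μ) / m.n) / m.μ) (m.lowPrice PM) PM := by
  have hlow := m.lowPrice_eq PM
  have ha := m.searchers_pos
  have hμ := m.μ_pos
  have hPM := hF.reserve_pos
  set α := (1 - m.μ) / m.n
  set L := m.lowPrice PM
  have hL : 0 < L := by
    have : 0 < L * (m.μ + α) := hlow ▸ mul_pos hPM ha
    exact pos_of_mul_pos_left this (by linarith)
  have hLPM : L < PM := by
    by_contra! hle
    nlinarith [mul_pos hL hμ]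
  have htail : ∀ p B : ℝ, 0 < p → (B ≤ (PM * α / p - α) / m.μ ↔ p * (α + m.μ * B) ≤ PM * α) := by
    intro p B hp
    rw [le_div_iff₀ hμ, le_sub_iff_add_le, le_div_iff₀ hp, mul_comm p, add_comm α, mul_comm B]
  have hmem : ∀ i, ∀ᵐ p ∂(F i : Measure ℝ), p ∈ Icc L PM := fun i => by
    filter_upwards [hF.ae_price_mul_eq i] with p ⟨hp, hpi⟩
    refine ⟨?_, hp.2⟩
    rw [hF.profit_eq] at hpi
    have h1 : rivalTail (fun j => (F j : Measure ℝ)) i p ≤ 1 := rivalTail_le_one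
    have h2 : L * (m.μ + α) ≤ p * (m.μ + α) := by
      rw [hlow, ← hpi]
      refine mul_le_mul_of_nonneg_left ?_ hp.1.le
      nlinarith
    exact le_of_mul_le_mul_right h2 (by linarith)
  refine ⟨hLPM, fun p hp => ?_, fun p hp q hq hpq => ?_, ?_, ?_, hmem, fun i p hp => ?_,
    fun i => ?_, fun i j hij p hi hj => hF.rivalTail_eq_zero_of_tie hij hi hj⟩
  · have hp0 : p ≠ 0 := (hL.trans_le hp.1).ne'
    exact ((continuousAt_const.div continuousAt_id hp0).sub continuousAt_const).div_const _
  · have hp0 : 0 < p := hL.trans_le hp.1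
    have := mul_pos hPM ha
    gcongr
  · rw [← hlow, mul_div_cancel_left₀ _ hL.ne', add_sub_cancel_right, div_self hμ.ne']
  · rw [mul_div_cancel_left₀ _ hPM.ne', sub_self, zero_div]
  · have hp0 : 0 < p := hL.trans_le hp.1
    rw [htail p _ hp0, ← hF.profit_eq i]
    exact hF.price_mul_le_profit i ⟨hp0, hp.2⟩
  · filter_upwards [hF.ae_price_mul_eq i] with p ⟨hp, hpi⟩
    rw [hF.profit_eq] at hpi
    rw [eq_div_iff hμ.ne', eq_sub_iff_add_eq, eq_div_iff hp.1.ne', ← hpi]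
    ring

end IsNash

end StahlModel

theorem theorem1 (m : StahlModel) (PM : ℝ) (F : Fin m.n → ProbabilityMeasure ℝ)
    (hF : m.IsNash PM F) :
    (∃ D : ProbabilityMeasure ℝ,
      -- the common distribution is continuous, with full support on `[P_L, P_M]`
      Continuous (cdf (D : Measure ℝ)) ∧
      (D : Measure ℝ).support = Icc (m.lowPrice PM) PM ∧
      -- at least two sellers use it
      (∃ i j : Fin m.n, i ≠ j ∧ F i = D ∧ F j = D) ∧
      -- every seller belongs to one of the three groups
      ∀ i : Fin m.n,
        F i = D ∨
        (F i : Measure ℝ) = Measure.dirac PM ∨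
        ∃ p : ℝ, m.HasCutoff PM (F i) p ∧
          ∀ x ≤ p, cdf (F i : Measure ℝ) x = cdf (D : Measure ℝ) x) ∧
    ∀ i : Fin m.n, m.profit PM F i = PM * (1 - m.μ) / m.n := by
  have H := hF.tailEquilibrium
  refine ⟨?_, fun i => by rw [hF.profit_eq, mul_div_assoc]⟩
  -- The first use only produces some fully tight seller; excluding that one produces the second.
  obtain ⟨i₀, -, hi₀⟩ := H.exists_ne_forall_tight (Classical.arbitrary _)
  obtain ⟨i₁, hne, hi₁⟩ := H.exists_ne_forall_tight i₀
  refine ⟨F i₀, H.continuous_cdf_of_forall_tight hi₀, H.support_of_forall_tight hi₀,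
    ⟨i₀, i₁, hne.symm, rfl, Subtype.ext (H.eq_of_forall_tight hi₁ hi₀)⟩, fun j => ?_⟩
  by_cases hj : ∀ p ∈ Ico (m.lowPrice PM) PM,
      StahlModel.rivalTail (fun j => (F j : Measure ℝ)) j p =
        (PM * ((1 - m.μ) / m.n) / p - (1 - m.μ) / m.n) / m.μ
  · exact Or.inl (Subtype.ext (H.eq_of_forall_tight hj hi₀))
  · obtain ⟨c, hc, hcj, h0⟩ := H.exists_cutoff hj
    -- A cutoff equal to `P_L` leaves no mass below `PM`: this is the pure strategy.
    rcases hc.1.eq_or_lt with rfl | hlt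
    · exact Or.inr (Or.inl (H.eq_dirac_of_cutoff h0))
    · refine Or.inr (Or.inr ⟨c, ⟨hlt, hc.2, H.support_of_cutoff hi₀ ⟨hlt, hc.2⟩ hcj h0, ?_⟩,
        fun x hx => ?_⟩)
      · have h1 := H.measure_right_of_cutoff hc h0
        have h2 : 0 < ((F j : Measure ℝ)).real {PM} := h1 ▸ H.upperTail_pos hc
        exact (ENNReal.toReal_pos_iff.1 h2).1
      · have hxb := hx.trans_lt hc.2
        have h1 := H.cdf_eq_one_sub (i := j) hxb
        have h2 := H.cdf_eq_one_sub (i := i₀) hxb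
        rw [H.upperTail_eq_of_le_of_tight hi₀ hc hcj hx] at h1
        exact h1.trans h2.symm
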